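/- **Theorem (SPARQ-SGD, smooth non-convex objective, constant step size).** There is an absolute constant $K>0$ such that the following holds for all integers $n,T\ge 1$, $d,H\ge 0$. *Objective.* Let $f_1,\dots,f_n:\mathbb R^d\to\mathbb R$ be $L$-smooth, i.e. differentiable with $L$-Lipschitz gradient ($L\ge 0$), possibly non-convex, and let $f=\frac1n\sum_i f_i$ be bounded below, $f^*=\inf f$. For each node $i\in[n]$ let $\nabla F_i(x,\xi)$, $\xi\sim\mathcal D_i$, be a (jointly measurable) stochastic gradient with $\mathbb E\,\nabla F_i(x,\xi)=\nabla f_i(x)$, $\mathbb E\|\nabla F_i(x,\xi)\|^2\le G^2$ and $\mathbb E\|\nabla F_i(x,\xi)-\nabla f_i(x)\|^2\le\sigma_i^2$ for all $x$, and put $\bar\sigma^2=\frac1n\sum_i\sigma_i^2$. *Compression and mixing.* Let $\mathcal C$ be a randomized compression operator with parameter $\omega\in(0,1]$: $\mathbb E_{\mathcal C}\|\mathcal C(x)-x\|^2\le(1-\omega)\|x\|^2$ for all $x$. Let $W=(w_{ij})\in\mathbb R^{n\times n}$ be symmetric and doubly stochastic, with second largest absolute value of an eigenvalue $|\lambda_2(W)|<1$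 (taken to be $0$ if $n=1$). Put $\delta=1-|\lambda_2(W)|$, $\beta=\max_i(1-\lambda_i(W))$, $$\gamma=\frac{2\delta\omega}{64\delta+\delta^2+16\beta^2+8\delta\beta^2-16\delta\omega},\qquad p=\frac{\gamma\delta}{8}.$$ *Algorithm.* Let $\mathcal I_T\subseteq\{0,\dots,T\}$ contain $0$ and $T$, with consecutive elements at most $H$ apart; let $\eta=\sqrt{n/T}$ with $T\ge 64nL^2$, let $\varepsilon\in(0,1)$, and let the thresholds satisfy $c_t\le\eta^{-(1-\varepsilon)}$ for all $0\le t<T$. Start from $x_i^{(0)}=\hat x_i^{(0)}=x_0$ for all $i$. At step $t$ every node sets $x_i^{(t+1/2)}=x_i^{(t)}-\eta\nabla F_i(x_i^{(t)},\xi_i^{(t)})$. If $t+1\notin\mathcal I_T$, then $x_i^{(t+1)}=x_i^{(t+1/2)}$ and $\hat x_i^{(t+1)}=\hat x_i^{(t)}$. If $t+1\in\mathcal I_T$, then $$\hat x_i^{(t+1)}=\begin{cases}\hat x_i^{(t)}+\mathcal C\big(x_i^{(t+1/2)}-\hat x_i^{(t)}\big)&\text{if }\|x_i^{(t+1/2)}-\hat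 x_i^{(t)}\|^2>c_t\eta^2,\\ \hat x_i^{(t)}&\text{otherwise,}\end{cases}$$ $$x_i^{(t+1)}=x_i^{(t+1/2)}+\gamma\sum_{j}w_{ij}\big(\hat x_j^{(t+1)}-\hat x_i^{(t+1)}\big).$$ All samples $\xi_i^{(t)}\sim\mathcal D_i$ and all internal random choices of $\mathcal C$ (one for each node and time) are mutually independent. *Conclusion.* The averages $\bar x^{(t)}=\frac1n\sum_i x_i^{(t)}$ satisfy $\mathbb E\|\nabla f(\bar x^{(t)})\|^2<\infty$ for $0\le t<T$ and $$\frac1T\sum_{t=0}^{T-1}\mathbb E\|\nabla f(\bar x^{(t)})\|^2\le\frac{4\big(f(x_0)-f^*+L\bar\sigma^2\big)}{\sqrt{nT}}+K\frac{G^2H^2L^2n}{p^2T}+K\frac{G^2H^2L^3n^{3/2}}{p^2T^{3/2}}+K\frac{L^2\omega}{p}\Big(\frac nT\Big)^{\frac{1+\varepsilon}2}+K\frac{L^3\omega}{p}\Big(\frac nT\Big)^{\frac{2+\varepsilon}2}.$$ -/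

import Mathlib

open MeasureTheory ProbabilityTheory

namespace SparqSGD

noncomputable section

/-- `f` is `L`-smooth: differentiable with `L`-Lipschitz gradient. -/
def LSmooth {d : ℕ} (L : ℝ) (f : EuclideanSpace ℝ (Fin d) → ℝ) : Prop :=
  Differentiable ℝ f ∧ ∀ x y, ‖gradient f x - gradient f y‖ ≤ L * ‖x - y‖

/-- The global objective `f = (1/n) ∑ f_i`. -/
def objective {n d : ℕ} (f : Fin n → EuclideanSpace ℝ (Fin d) → ℝ)
    (x : EuclideanSpace ℝ (Fin d)) : ℝ :=
  (1 / (n : ℝ)) * ∑ i, f i x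

/-- `g x s` (written `∇F(x, s)` in the literature) is a stochastic gradient of `f` for samples
`s ∼ D`: unbiased, with second moment at most `G ^ 2` and variance at most `σ ^ 2`. -/
structure IsStochasticGradient {d : ℕ} {Ξ : Type*} [MeasurableSpace Ξ] (D : Measure Ξ)
    (f : EuclideanSpace ℝ (Fin d) → ℝ)
    (g : EuclideanSpace ℝ (Fin d) → Ξ → EuclideanSpace ℝ (Fin d)) (G σ : ℝ) : Prop where
  measurable : Measurable (Function.uncurry g)
  unbiased : ∀ x, ∫ s, g x s ∂D = gradient f x
  integrable_sq : ∀ x, Integrable (fun s => ‖g x s‖ ^ 2) D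
  second_moment_le : ∀ x, ∫ s, ‖g x s‖ ^ 2 ∂D ≤ G ^ 2
  variance_le : ∀ x, ∫ s, ‖g x s - gradient f x‖ ^ 2 ∂D ≤ σ ^ 2

/-- `C x z` is a (randomized) compression operator with parameter `ω`; the internal randomness
`z` has law `ν`. -/
structure IsCompression {d : ℕ} {Z : Type*} [MeasurableSpace Z] (ν : Measure Z)
    (C : EuclideanSpace ℝ (Fin d) → Z → EuclideanSpace ℝ (Fin d)) (ω : ℝ) : Prop where
  measurable : Measurable (Function.uncurry C)
  integrable_sq : ∀ x, Integrable (fun z => ‖C x z - x‖ ^ 2) ν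
  contraction : ∀ x, ∫ z, ‖C x z - x‖ ^ 2 ∂ν ≤ (1 - ω) * ‖x‖ ^ 2

/-- `|λ₂(W)|`: the second largest absolute value of an eigenvalue of `W`, counted with
multiplicity, i.e. the least possible maximum of `|λ_j|` after one eigenvalue is left out.
It is `0` if `n = 1`. -/
def secondAbsEigenvalue {n : ℕ} {W : Matrix (Fin n) (Fin n) ℝ} (hW : W.IsHermitian) : ℝ :=
  ⨅ i : Fin n, ⨆ j : {j : Fin n // j ≠ i}, |hW.eigenvalues j|

/-- The spectral gap `δ = 1 - |λ₂(W)|`. -/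
def spectralGap {n : ℕ} {W : Matrix (Fin n) (Fin n) ℝ} (hW : W.IsHermitian) : ℝ :=
  1 - secondAbsEigenvalue hW

/-- `β = max_i (1 - λ_i(W))`. -/
def beta {n : ℕ} {W : Matrix (Fin n) (Fin n) ℝ} (hW : W.IsHermitian) : ℝ :=
  ⨆ i : Fin n, (1 - hW.eigenvalues i)

/-- The consensus step size `γ`, as a function of `δ`, `β` and `ω`. -/
def consensusStep (δ β ω : ℝ) : ℝ :=
  2 * δ * ω / (64 * δ + δ ^ 2 + 16 * β ^ 2 + 8 * δ * β ^ 2 - 16 * δ * ω)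

/-- `I` is a set of synchronization indices in `{0, …, T}`, containing both ends, whose
consecutive elements are at most `H` apart. -/
structure IsSyncSet (I : Finset ℕ) (T H : ℕ) : Prop where
  subset : I ⊆ Finset.range (T + 1)
  zero_mem : 0 ∈ I
  last_mem : T ∈ I
  gap_le : ∀ s ∈ I, ∀ s' ∈ I, s < s' → (∀ r ∈ I, ¬ (s < r ∧ r < s')) → s' - s ≤ H

/-- The parameters `x_i` of the nodes and the estimates `x̂_i` of them. -/
structure State (n d : ℕ) where
  x : Fin n → EuclideanSpace ℝ (Fin d)
  xhat : Fin n → EuclideanSpace ℝ (Fin d)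

/-- The average `x̄` of the node parameters. -/
def State.mean {n d : ℕ} (S : State n d) : EuclideanSpace ℝ (Fin d) :=
  (1 / (n : ℝ)) • ∑ i, S.x i

/-- The local SGD step `x_i^{(t+1/2)}`. -/
def halfStep {n d : ℕ} (η : ℝ) (grad : Fin n → EuclideanSpace ℝ (Fin d)) (S : State n d)
    (i : Fin n) : EuclideanSpace ℝ (Fin d) :=
  S.x i - η • grad i

/-- The estimates after a synchronization: node `i` broadcasts the compressed difference exactly
if the squared norm of the difference exceeds the threshold `c * η ^ 2`. -/
def newEstimate {n d : ℕ} (η c : ℝ) (grad : Fin n → EuclideanSpace ℝ (Fin d))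
    (comp : Fin n → EuclideanSpace ℝ (Fin d) → EuclideanSpace ℝ (Fin d)) (S : State n d)
    (i : Fin n) : EuclideanSpace ℝ (Fin d) :=
  open Classical in
  if c * η ^ 2 < ‖halfStep η grad S i - S.xhat i‖ ^ 2 then
    S.xhat i + comp i (halfStep η grad S i - S.xhat i)
  else S.xhat i

/-- One iteration of SPARQ-SGD at a time that is not followed by a synchronization index. -/
def localStep {n d : ℕ} (η : ℝ) (grad : Fin n → EuclideanSpace ℝ (Fin d)) (S : State n d) :
    State n d where
  x := halfStep η grad S
  xhat := S.xhat

/-- One iteration of SPARQ-SGD at a time that is followed by a synchronization index. -/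
def syncStep {n d : ℕ} (W : Matrix (Fin n) (Fin n) ℝ) (γ η c : ℝ)
    (grad : Fin n → EuclideanSpace ℝ (Fin d))
    (comp : Fin n → EuclideanSpace ℝ (Fin d) → EuclideanSpace ℝ (Fin d)) (S : State n d) :
    State n d where
  x := fun i => halfStep η grad S i +
    γ • ∑ j, W i j • (newEstimate η c grad comp S j - newEstimate η c grad comp S i)
  xhat := newEstimate η c grad comp S

/-- SPARQ-SGD, along one realization of the samples `ξ i t` and of the internal randomness
`ζ i t` of the compression operator. All nodes and all estimates start at `x₀`. -/
def iterate {n d : ℕ} {Ξ : Fin n → Type*} {Z : Type*} (W : Matrix (Fin n) (Fin n) ℝ) (γ : ℝ)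
    (η c : ℕ → ℝ) (I : Finset ℕ)
    (g : (i : Fin n) → EuclideanSpace ℝ (Fin d) → Ξ i → EuclideanSpace ℝ (Fin d))
    (C : EuclideanSpace ℝ (Fin d) → Z → EuclideanSpace ℝ (Fin d))
    (x₀ : EuclideanSpace ℝ (Fin d)) (ξ : (i : Fin n) → ℕ → Ξ i) (ζ : Fin n → ℕ → Z) :
    ℕ → State n d
  | 0 => ⟨fun _ => x₀, fun _ => x₀⟩
  | t + 1 =>
    let S := iterate W γ η c I g C x₀ ξ ζ t
    let grad := fun i => g i (S.x i) (ξ i t)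
    if t + 1 ∈ I then syncStep W γ (η t) (c t) grad (fun i v => C v (ζ i t)) S
    else localStep (η t) grad S

/-- All samples `ξ i t` and all compression seeds `ζ i t` are measurable, `ξ i t` has law `D i`,
`ζ i t` has law `ν`, and all of them together are mutually independent. -/
structure IsSampling {n : ℕ} {Ξ : Fin n → Type*} [∀ i, MeasurableSpace (Ξ i)] {Z : Type*}
    [MeasurableSpace Z] {Ω : Type*} [MeasurableSpace Ω] (P : Measure Ω)
    (D : (i : Fin n) → Measure (Ξ i)) (ν : Measure Z)
    (ξ : (i : Fin n) → ℕ → Ω → Ξ i) (ζ : Fin n → ℕ → Ω → Z) : Prop where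
  measurable_sample : ∀ i t, Measurable (ξ i t)
  measurable_seed : ∀ i t, Measurable (ζ i t)
  law_sample : ∀ i t, P.map (ξ i t) = D i
  law_seed : ∀ i t, P.map (ζ i t) = ν
  indep : iIndep
    (Sum.elim
      (fun a : Fin n × ℕ => MeasurableSpace.comap (ξ a.1 a.2) inferInstance)
      (fun a : Fin n × ℕ => MeasurableSpace.comap (ζ a.1 a.2) inferInstance)) P

end

end SparqSGD

/-!
The proof is a descent argument for the averaged iterates, combined with a contraction argument for
the disagreement of the nodes.

*Descent.* `W` is doubly stochastic, so gossip does not move the average of the nodes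
(`IsTrajectory.avg_succ`): it performs a stochastic gradient step whose direction is the average of
the local stochastic gradients. The noises of different nodes at one time are orthogonal, and each
of them is orthogonal to everything that is determined by the past, so one step decreases the
expected objective by `η / 2 * E ‖∇f(x̄)‖ ^ 2`, up to the variance term
`L * η ^ 2 / (2 * n) * σ̄ ^ 2` and the term `η * L ^ 2 / (2 * n) * E ∑ i, ‖x i - x̄‖ ^ 2`, which comes
from evaluating the local gradients at `x i` instead of `x̄`
(`IsRun.integral_objective_succ_le`). Telescoping leaves the expected disagreement
`E ∑ i, ‖x i - x̄‖ ^ 2` to be bounded.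

*Consensus.* The potential `∑ i, ‖x i - x̄‖ ^ 2 + ∑ i, ‖x i - x̂ i‖ ^ 2` is followed from one
synchronization to the next. In the eigenbasis of `W` a gossip step shrinks the disagreement by
`1 - γ * δ`, while the error of the estimates grows by at most `1 + 3 / 4 * ω`
(`disagreement_add_sqDist_gossip_le`); compression shrinks that error by `1 - ω`, except that a node
which stays silent contributes at most `ω` times its threshold. The choice of `γ` makes the potential
contract by `1 - 3 * p` (`IsRun.integral_potential_sync_le`). The at most `H` local steps in between
cost at most `2 * (1 + 1 / p) * η ^ 2 * H ^ 2 * G ^ 2` per node. The fixed point of this recursion is of order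
`n * (η ^ 2 * H ^ 2 * G ^ 2 / p ^ 2 + ω * η ^ (1 + ε) / p)` (`IsRun.integral_potential_le`), and
`η ^ 2 = n / T` turns it into the asserted rate, with `K = 10`. The terms with `L ^ 3` are only
needed to be nonnegative.

Independence is used through two instances of Fubini's theorem, `integral_le_of_indepFun` and
`integral_eq_zero_of_indepFun`: the state at time `t` is a function of the randomness before `t`,
hence independent of every sample and every seed of time `t`.
-/

namespace SparqSGD

/-! ### Spectral estimates for the mixing matrix -/

/-- The gossip direction `∑ j, W i j (x j - x i)` of node `i`; for a doubly stochastic `W` this is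
the `i`-th row of `(W - 1) x`. -/
def gossip {n : ℕ} {E : Type*} [AddCommGroup E] [Module ℝ E] (W : Matrix (Fin n) (Fin n) ℝ)
    (x : Fin n → E) (i : Fin n) : E :=
  ∑ j, W i j • (x j - x i)

section Spectral

variable {n : ℕ} {W : Matrix (Fin n) (Fin n) ℝ}

/-- The coefficient of `x` along the `j`-th eigenvector of `W`. -/
noncomputable def eigenCoeff (hW : W.IsHermitian) (x : Fin n → ℝ) (j : Fin n) : ℝ :=
  hW.eigenvectorBasis j ⬝ᵥ x

lemma sum_sq_eq_sum_eigenCoeff_sq (hW : W.IsHermitian) (x : Fin n → ℝ) :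
    ∑ i, x i ^ 2 = ∑ j, eigenCoeff hW x j ^ 2 := by
  have h := hW.eigenvectorBasis.sum_sq_norm_inner_right (WithLp.toLp 2 x)
  rw [EuclideanSpace.real_norm_sq_eq] at h
  rw [← h]
  refine Finset.sum_congr rfl fun j _ => ?_
  rw [Real.norm_eq_abs, sq_abs, EuclideanSpace.inner_eq_star_dotProduct, dotProduct_comm]
  simp [eigenCoeff]

lemma gossip_eq_mulVec_sub (hds : W ∈ doublyStochastic ℝ (Fin n)) (x : Fin n → ℝ) :
    gossip W x = W.mulVec x - x := by
  funext i
  simp only [gossip, smul_eq_mul, mul_sub, Finset.sum_sub_distrib, ← Finset.sum_mul,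
    sum_row_of_mem_doublyStochastic hds, one_mul, Pi.sub_apply]
  rfl

lemma eigenCoeff_mulVec (hW : W.IsHermitian) (x : Fin n → ℝ) (j : Fin n) :
    eigenCoeff hW (W.mulVec x) j = hW.eigenvalues j * eigenCoeff hW x j := by
  have hT : W.transpose = W := by rwa [Matrix.IsHermitian, Matrix.conjTranspose_eq_transpose_of_trivial] at hW
  rw [eigenCoeff, Matrix.dotProduct_mulVec, ← Matrix.mulVec_transpose, hT,
    hW.mulVec_eigenvectorBasis, smul_dotProduct]
  rfl

/-- Affine functions of the gossip operator act diagonally in the eigenbasis of `W`. -/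
lemma sum_sq_add_gossip (hW : W.IsHermitian) (hds : W ∈ doublyStochastic ℝ (Fin n))
    (x : Fin n → ℝ) (a b : ℝ) :
    ∑ i, (a * x i + b * gossip W x i) ^ 2 =
      ∑ j, (a - b * (1 - hW.eigenvalues j)) ^ 2 * eigenCoeff hW x j ^ 2 := by
  have h := sum_sq_eq_sum_eigenCoeff_sq hW (a • x + b • gossip W x)
  have h2 : ∀ i, (a • x + b • gossip W x) i = a * x i + b * gossip W x i := fun i => rfl
  simp only [h2] at h
  rw [h]
  refine Finset.sum_congr rfl fun j _ => ?_
  have h3 : eigenCoeff hW (a • x + b • gossip W x) j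
      = (a - b * (1 - hW.eigenvalues j)) * eigenCoeff hW x j := by
    have h4 := eigenCoeff_mulVec hW x j
    rw [gossip_eq_mulVec_sub hds]
    simp only [eigenCoeff, dotProduct_add, dotProduct_smul, dotProduct_sub, smul_eq_mul] at h4 ⊢
    rw [h4]; ring
  rw [h3]; ring

lemma secondAbsEigenvalue_nonneg (hW : W.IsHermitian) : 0 ≤ secondAbsEigenvalue hW :=
  Real.iInf_nonneg fun _ => Real.iSup_nonneg fun _ => abs_nonneg _

/-- The consensus direction carries the eigenvalue `1`, the other eigenvalues are bounded by
`|λ₂(W)|` in absolute value, and vectors of mean zero have no component in the consensus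
direction: all other eigenvalues differ from `1`, so the all-ones vector, which `W` fixes, is a
multiple of the remaining eigenvector. -/
lemma exists_consensus_index (hn : 0 < n) (hW : W.IsHermitian)
    (hds : W ∈ doublyStochastic ℝ (Fin n)) (h2 : secondAbsEigenvalue hW < 1) :
    ∃ i₀, hW.eigenvalues i₀ = 1 ∧
      (∀ j ≠ i₀, |hW.eigenvalues j| ≤ secondAbsEigenvalue hW) ∧
      ∀ x : Fin n → ℝ, ∑ i, x i = 0 → eigenCoeff hW x i₀ = 0 := by
  have : Nonempty (Fin n) := ⟨⟨0, hn⟩⟩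
  obtain ⟨i₀, hi₀⟩ := exists_eq_ciInf_of_finite
    (f := fun i : Fin n => ⨆ j : {j : Fin n // j ≠ i}, |hW.eigenvalues j|)
  have hle : ∀ j ≠ i₀, |hW.eigenvalues j| ≤ secondAbsEigenvalue hW := by
    intro j hj
    rw [secondAbsEigenvalue, ← hi₀]
    exact le_ciSup (f := fun j : {j : Fin n // j ≠ i₀} => |hW.eigenvalues j|)
      (Set.finite_range _).bddAbove ⟨j, hj⟩
  set o : Fin n → ℝ := 1 with ho
  have hWo : W.mulVec o = o := (mem_doublyStochastic.1 hds).2.1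
  have hfix : ∀ j, eigenCoeff hW o j = hW.eigenvalues j * eigenCoeff hW o j := by
    intro j
    conv_lhs => rw [← hWo]
    exact eigenCoeff_mulVec hW o j
  have hzero : ∀ j ≠ i₀, eigenCoeff hW o j = 0 := by
    intro j hj
    have h3 : hW.eigenvalues j < 1 := lt_of_le_of_lt (le_abs_self _) ((hle j hj).trans_lt h2)
    have h4 := hfix j
    by_contra hne
    have : hW.eigenvalues j = 1 := by
      field_simp at h4
      linarith
    linarith
  have hsq : eigenCoeff hW o i₀ ^ 2 = n := by
    have h5 := sum_sq_eq_sum_eigenCoeff_sq hW o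
    rw [Finset.sum_eq_single (f := fun j => eigenCoeff hW o j ^ 2) i₀
      (fun j _ hj => by rw [hzero j hj]; simp) (by simp)] at h5
    rw [← h5]; simp [ho]
  have hne : eigenCoeff hW o i₀ ≠ 0 := by
    intro h
    rw [h] at hsq
    have : (0 : ℝ) < n := by exact_mod_cast hn
    norm_num at hsq
    linarith
  refine ⟨i₀, ?_, hle, fun x hx => ?_⟩
  · have h4 := hfix i₀
    field_simp at h4
    linarith
  · -- Parseval for the pairing of `x` with the all-ones vector, by polarization
    have hp := sum_sq_eq_sum_eigenCoeff_sq hW (x + o)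
    have hm := sum_sq_eq_sum_eigenCoeff_sq hW (x - o)
    have hL : ∑ i, (x + o) i ^ 2 - ∑ i, (x - o) i ^ 2 = 4 * ∑ i, x i := by
      rw [← Finset.sum_sub_distrib, Finset.mul_sum]
      exact Finset.sum_congr rfl fun i _ => by simp [ho]; ring
    have hR : ∑ j, eigenCoeff hW (x + o) j ^ 2 - ∑ j, eigenCoeff hW (x - o) j ^ 2
        = 4 * (eigenCoeff hW x i₀ * eigenCoeff hW o i₀) := by
      rw [← Finset.sum_sub_distrib, Finset.sum_eq_single i₀]
      · simp only [eigenCoeff, dotProduct_add, dotProduct_sub]; ring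
      · intro j _ hj
        have := hzero j hj
        simp only [eigenCoeff, dotProduct_add, dotProduct_sub] at this ⊢
        rw [this]; ring
      · simp
    rw [hp, hm, hR, hx] at hL
    have : eigenCoeff hW x i₀ * eigenCoeff hW o i₀ = 0 := by linarith
    exact (mul_eq_zero.1 this).resolve_right hne

lemma one_sub_eigenvalue_le_beta (hW : W.IsHermitian) (j : Fin n) :
    1 - hW.eigenvalues j ≤ beta hW :=
  le_ciSup (f := fun i => 1 - hW.eigenvalues i) (Set.finite_range _).bddAbove j

lemma one_sub_eigenvalue_nonneg (hn : 0 < n) (hW : W.IsHermitian)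
    (hds : W ∈ doublyStochastic ℝ (Fin n)) (h2 : secondAbsEigenvalue hW < 1) (j : Fin n) :
    0 ≤ 1 - hW.eigenvalues j := by
  obtain ⟨i₀, h1, hle, -⟩ := exists_consensus_index hn hW hds h2
  by_cases hj : j = i₀
  · rw [hj, h1]; simp
  · linarith [hle j hj, le_abs_self (hW.eigenvalues j)]

lemma beta_nonneg (hn : 0 < n) (hW : W.IsHermitian)
    (hds : W ∈ doublyStochastic ℝ (Fin n)) (h2 : secondAbsEigenvalue hW < 1) : 0 ≤ beta hW :=
  (one_sub_eigenvalue_nonneg hn hW hds h2 ⟨0, hn⟩).trans (one_sub_eigenvalue_le_beta hW _)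

/-- A single node has `β = 0`; as soon as there are two nodes, `β` dominates the spectral gap. -/
lemma beta_eq_zero_or_spectralGap_le (hn : 0 < n) (hW : W.IsHermitian)
    (hds : W ∈ doublyStochastic ℝ (Fin n)) (h2 : secondAbsEigenvalue hW < 1) :
    beta hW = 0 ∨ spectralGap hW ≤ beta hW := by
  obtain ⟨i₀, h1, hle, -⟩ := exists_consensus_index hn hW hds h2
  by_cases h : ∃ j, j ≠ i₀
  · obtain ⟨j, hj⟩ := h
    right
    have := one_sub_eigenvalue_le_beta hW j
    rw [spectralGap]
    linarith [hle j hj, le_abs_self (hW.eigenvalues j)]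
  · push Not at h
    left
    have : Nonempty (Fin n) := ⟨i₀⟩
    have h3 : ∀ i, 1 - hW.eigenvalues i = 0 := fun i => by rw [h i, h1]; simp
    simp [beta, h3]

lemma sum_sq_gossip_le (hn : 0 < n) (hW : W.IsHermitian)
    (hds : W ∈ doublyStochastic ℝ (Fin n)) (h2 : secondAbsEigenvalue hW < 1) (x : Fin n → ℝ) :
    ∑ i, gossip W x i ^ 2 ≤ beta hW ^ 2 * ∑ i, x i ^ 2 := by
  have h := sum_sq_add_gossip hW hds x 0 1
  simp only [zero_mul, one_mul, zero_add] at h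
  rw [h, sum_sq_eq_sum_eigenCoeff_sq hW x, Finset.mul_sum]
  refine Finset.sum_le_sum fun j _ => mul_le_mul_of_nonneg_right ?_ (sq_nonneg _)
  have h3 := one_sub_eigenvalue_nonneg hn hW hds h2 j
  have h4 := one_sub_eigenvalue_le_beta hW j
  nlinarith

lemma sum_sq_sub_gossip_le (hn : 0 < n) (hW : W.IsHermitian)
    (hds : W ∈ doublyStochastic ℝ (Fin n)) (h2 : secondAbsEigenvalue hW < 1) {γ : ℝ}
    (hγ : 0 ≤ γ) (x : Fin n → ℝ) :
    ∑ i, (x i - γ * gossip W x i) ^ 2 ≤ (1 + γ * beta hW) ^ 2 * ∑ i, x i ^ 2 := by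
  have h := sum_sq_add_gossip hW hds x 1 (-γ)
  have h0 : ∀ i, x i - γ * gossip W x i = 1 * x i + -γ * gossip W x i := fun i => by ring
  simp only [h0]
  rw [h, sum_sq_eq_sum_eigenCoeff_sq hW x, Finset.mul_sum]
  refine Finset.sum_le_sum fun j _ => mul_le_mul_of_nonneg_right ?_ (sq_nonneg _)
  have h3 := one_sub_eigenvalue_nonneg hn hW hds h2 j
  have h4 := one_sub_eigenvalue_le_beta hW j
  have h5 := mul_le_mul_of_nonneg_left h4 hγ
  have h6 := mul_nonneg hγ h3
  exact pow_le_pow_left₀ (by linarith) (by linarith) 2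

/-- On vectors of mean zero a gossip step contracts by the factor `1 - γ δ`. -/
lemma sum_sq_add_gossip_le (hn : 0 < n) (hW : W.IsHermitian)
    (hds : W ∈ doublyStochastic ℝ (Fin n)) (h2 : secondAbsEigenvalue hW < 1) {γ : ℝ}
    (hγ : 0 ≤ γ) (hγ1 : γ ≤ 1) (x : Fin n → ℝ) (hx : ∑ i, x i = 0) :
    ∑ i, (x i + γ * gossip W x i) ^ 2 ≤ (1 - γ * spectralGap hW) ^ 2 * ∑ i, x i ^ 2 := by
  have h := sum_sq_add_gossip hW hds x 1 γ
  simp only [one_mul] at h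
  obtain ⟨i₀, h1, hle, hc⟩ := exists_consensus_index hn hW hds h2
  rw [h, sum_sq_eq_sum_eigenCoeff_sq hW x, Finset.mul_sum]
  refine Finset.sum_le_sum fun j _ => ?_
  by_cases hj : j = i₀
  · rw [hj, hc x hx]; simp
  refine mul_le_mul_of_nonneg_right ?_ (sq_nonneg _)
  obtain ⟨h3, h4⟩ := abs_le.1 (hle j hj)
  have h0 := secondAbsEigenvalue_nonneg hW
  rw [spectralGap]
  refine sq_le_sq' ?_ ?_
  · nlinarith [mul_nonneg hγ h0, mul_le_mul_of_nonneg_left h3 hγ]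
  · nlinarith [mul_le_mul_of_nonneg_left h4 hγ]

end Spectral

/-! ### One gossip step contracts the consensus potential -/

lemma add_sq_le_weighted {θ : ℝ} (hθ : 0 < θ) (a b : ℝ) :
    (a + b) ^ 2 ≤ (1 + θ) * a ^ 2 + (1 + 1 / θ) * b ^ 2 := by
  have h : (1 + θ) * a ^ 2 + (1 + 1 / θ) * b ^ 2 - (a + b) ^ 2 = (θ * a - b) ^ 2 / θ := by
    field_simp; ring
  have h2 : 0 ≤ (θ * a - b) ^ 2 / θ := by positivity
  linarith

lemma norm_add_sq_le_weighted {E : Type*} [SeminormedAddCommGroup E] {θ : ℝ} (hθ : 0 < θ)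
    (a b : E) : ‖a + b‖ ^ 2 ≤ (1 + θ) * ‖a‖ ^ 2 + (1 + 1 / θ) * ‖b‖ ^ 2 :=
  (pow_le_pow_left₀ (norm_nonneg _) (norm_add_le a b) 2).trans (add_sq_le_weighted hθ _ _)

/-- The bounds on the consensus step size `γ` on which the contraction rests. -/
structure IsConsensusStep (γ δ β ω : ℝ) : Prop where
  pos : 0 < γ
  gap_pos : 0 < δ
  gap_le_one : δ ≤ 1
  beta_nonneg : 0 ≤ β
  omega_pos : 0 < ω
  omega_le_one : ω ≤ 1
  le : γ ≤ ω / 24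
  mul_beta_le : γ * β ≤ ω / 8
  mul_beta_sq_le : γ * β ^ 2 ≤ δ * ω / 8

lemma isConsensusStep_consensusStep {δ β ω : ℝ} (hδ : 0 < δ) (hδ1 : δ ≤ 1) (hβ : 0 ≤ β)
    (hδβ : β = 0 ∨ δ ≤ β) (hω : 0 < ω) (hω1 : ω ≤ 1) :
    IsConsensusStep (consensusStep δ β ω) δ β ω := by
  set D := 64 * δ + δ ^ 2 + 16 * β ^ 2 + 8 * δ * β ^ 2 - 16 * δ * ω with hD
  have h1 : δ * ω ≤ δ := by nlinarith
  have h2 : 0 ≤ δ * β ^ 2 := by positivity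
  have hD1 : 48 * δ + 16 * β ^ 2 ≤ D := by nlinarith [sq_nonneg δ]
  have hD0 : 0 < D := by nlinarith [sq_nonneg β]
  have hδω : 0 < δ * ω := mul_pos hδ hω
  have hγ : consensusStep δ β ω = 2 * δ * ω / D := rfl
  refine ⟨?_, hδ, hδ1, hβ, hω, hω1, ?_, ?_, ?_⟩
  · rw [hγ]; positivity
  · rw [hγ, div_le_iff₀ hD0]
    nlinarith [mul_le_mul_of_nonneg_left hD1 hω.le, mul_nonneg hω.le (sq_nonneg β)]
  · rcases hδβ with h | h
    · rw [h]; simp; positivity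
    · rw [hγ, div_mul_eq_mul_div, div_le_iff₀ hD0]
      have h3 : δ * β ≤ β ^ 2 := by nlinarith
      nlinarith [mul_le_mul_of_nonneg_left hD1 hω.le, mul_le_mul_of_nonneg_left h3 hω.le]
  · rw [hγ, div_mul_eq_mul_div, div_le_iff₀ hD0]
    nlinarith [mul_le_mul_of_nonneg_left hD1 hδω.le]

section Gossip

variable {n d : ℕ} {W : Matrix (Fin n) (Fin n) ℝ}

/-- One gossip step in scalar coordinates: `u` is the deviation of the nodes from their mean and
`z` the error of the estimates. -/
lemma sum_sq_gossip_step_le (hn : 0 < n) (hW : W.IsHermitian)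
    (hds : W ∈ doublyStochastic ℝ (Fin n)) (h2 : secondAbsEigenvalue hW < 1) {γ ω : ℝ}
    (hγ : IsConsensusStep γ (spectralGap hW) (beta hW) ω) (u z : Fin n → ℝ)
    (hu : ∑ i, u i = 0) :
    ∑ i, (u i + γ * gossip W u i - γ * gossip W z i) ^ 2
      + ∑ i, (z i + γ * gossip W u i - γ * gossip W z i) ^ 2
      ≤ (1 - 3 / 8 * (γ * spectralGap hW)) * ∑ i, u i ^ 2
        + (1 + 3 / 4 * ω) * ∑ i, z i ^ 2 := by
  obtain ⟨hγ0, hδ0, hδ1, hβ0, hω0, hω1, hγω, hγβ, hγβ2⟩ := hγ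
  set δ := spectralGap hW
  set β := beta hW
  have hγ1 : γ ≤ 1 := by linarith
  set s := γ * δ with hs
  have hs0 : 0 < s := mul_pos hγ0 hδ0
  have hs1 : s < 1 := by nlinarith
  have hUu := sum_sq_add_gossip_le hn hW hds h2 hγ0.le hγ1 u hu
  have hGz := sum_sq_gossip_le hn hW hds h2 z
  have hGu := sum_sq_gossip_le hn hW hds h2 u
  have hZz := sum_sq_sub_gossip_le hn hW hds h2 hγ0.le z
  have hU0 : 0 ≤ ∑ i, u i ^ 2 := Finset.sum_nonneg fun i _ => sq_nonneg _
  have hZ0 : 0 ≤ ∑ i, z i ^ 2 := Finset.sum_nonneg fun i _ => sq_nonneg _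
  have hfirst : ∑ i, (u i + γ * gossip W u i - γ * gossip W z i) ^ 2
      ≤ (1 - s) * ∑ i, u i ^ 2 + ω / 8 * ∑ i, z i ^ 2 := by
    have hpt : ∀ i, (u i + γ * gossip W u i - γ * gossip W z i) ^ 2
        ≤ 1 / (1 - s) * (u i + γ * gossip W u i) ^ 2 + γ ^ 2 / s * gossip W z i ^ 2 := by
      intro i
      have h1s : 0 < 1 - s := by linarith
      -- the weight making the two coefficients `1 / (1 - s)` and `1 / s`
      have h := add_sq_le_weighted (θ := s / (1 - s)) (by positivity)
        (u i + γ * gossip W u i) (-(γ * gossip W z i))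
      have e1 : 1 + s / (1 - s) = 1 / (1 - s) := by field_simp; ring
      have e2 : 1 + 1 / (s / (1 - s)) = 1 / s := by field_simp; ring
      rw [e1, e2] at h
      calc _ = (u i + γ * gossip W u i + -(γ * gossip W z i)) ^ 2 := by ring
        _ ≤ _ := h
        _ = _ := by ring
    refine (Finset.sum_le_sum fun i _ => hpt i).trans ?_
    rw [Finset.sum_add_distrib, ← Finset.mul_sum, ← Finset.mul_sum]
    have h1s : 0 < 1 - s := by linarith
    refine add_le_add ?_ ?_
    · calc 1 / (1 - s) * ∑ i, (u i + γ * gossip W u i) ^ 2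
          ≤ 1 / (1 - s) * ((1 - s) ^ 2 * ∑ i, u i ^ 2) :=
            mul_le_mul_of_nonneg_left hUu (by positivity)
        _ = _ := by field_simp
    · calc γ ^ 2 / s * ∑ i, gossip W z i ^ 2
          ≤ γ ^ 2 / s * (β ^ 2 * ∑ i, z i ^ 2) :=
            mul_le_mul_of_nonneg_left hGz (by positivity)
        _ = γ * β ^ 2 / δ * ∑ i, z i ^ 2 := by rw [hs]; field_simp
        _ ≤ _ := by
            refine mul_le_mul_of_nonneg_right ?_ hZ0
            rw [div_le_iff₀ hδ0]; linarith
  have hsecond : ∑ i, (z i + γ * gossip W u i - γ * gossip W z i) ^ 2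
      ≤ 5 / 8 * s * ∑ i, u i ^ 2 + (1 + 149 / 256 * ω) * ∑ i, z i ^ 2 := by
    have hpt : ∀ i, (z i + γ * gossip W u i - γ * gossip W z i) ^ 2
        ≤ (1 + ω / 4) * (z i - γ * gossip W z i) ^ 2
          + (1 + 4 / ω) * γ ^ 2 * gossip W u i ^ 2 := by
      intro i
      have h := add_sq_le_weighted (θ := ω / 4) (by positivity)
        (z i - γ * gossip W z i) (γ * gossip W u i)
      calc _ = (z i - γ * gossip W z i + γ * gossip W u i) ^ 2 := by ring
        _ ≤ _ := h
        _ = _ := by field_simp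
    refine (Finset.sum_le_sum fun i _ => hpt i).trans ?_
    rw [Finset.sum_add_distrib, ← Finset.mul_sum, ← Finset.mul_sum, add_comm]
    refine add_le_add ?_ ?_
    · calc (1 + 4 / ω) * γ ^ 2 * ∑ i, gossip W u i ^ 2
          ≤ (1 + 4 / ω) * γ ^ 2 * (β ^ 2 * ∑ i, u i ^ 2) :=
            mul_le_mul_of_nonneg_left hGu (by positivity)
        _ = ((1 + 4 / ω) * γ * (γ * β ^ 2)) * ∑ i, u i ^ 2 := by ring
        _ ≤ _ := by
            refine mul_le_mul_of_nonneg_right ?_ hU0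
            calc (1 + 4 / ω) * γ * (γ * β ^ 2) ≤ (1 + 4 / ω) * γ * (δ * ω / 8) :=
                  mul_le_mul_of_nonneg_left hγβ2 (by positivity)
              _ = s * (ω + 4) / 8 := by rw [hs]; field_simp
              _ ≤ _ := by nlinarith
    · calc (1 + ω / 4) * ∑ i, (z i - γ * gossip W z i) ^ 2
          ≤ (1 + ω / 4) * ((1 + γ * β) ^ 2 * ∑ i, z i ^ 2) :=
            mul_le_mul_of_nonneg_left hZz (by positivity)
        _ = ((1 + ω / 4) * (1 + γ * β) ^ 2) * ∑ i, z i ^ 2 := by ring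
        _ ≤ _ := by
            refine mul_le_mul_of_nonneg_right ?_ hZ0
            have h0 : 0 ≤ γ * β := mul_nonneg hγ0.le hβ0
            calc (1 + ω / 4) * (1 + γ * β) ^ 2 ≤ (1 + ω / 4) * (1 + ω / 8) ^ 2 := by gcongr
              _ ≤ _ := by nlinarith [mul_pos hω0 hω0, mul_pos (mul_pos hω0 hω0) hω0,
                  mul_le_mul_of_nonneg_left hω1 hω0.le,
                  mul_le_mul_of_nonneg_left hω1 (mul_pos hω0 hω0).le]
  nlinarith [mul_nonneg hω0.le hZ0]

/-- The average of a family of vectors. -/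
noncomputable def avg {E : Type*} [AddCommGroup E] [Module ℝ E] (x : Fin n → E) : E :=
  (1 / (n : ℝ)) • ∑ i, x i

/-- The squared distance of a family of vectors from its average. -/
noncomputable def disagreement (x : Fin n → EuclideanSpace ℝ (Fin d)) : ℝ :=
  ∑ i, ‖x i - avg x‖ ^ 2

/-- The squared distance between two families of vectors. -/
noncomputable def sqDist (x y : Fin n → EuclideanSpace ℝ (Fin d)) : ℝ :=
  ∑ i, ‖x i - y i‖ ^ 2

lemma disagreement_nonneg (x : Fin n → EuclideanSpace ℝ (Fin d)) : 0 ≤ disagreement x :=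
  Finset.sum_nonneg fun _ _ => sq_nonneg _

lemma sqDist_nonneg (x y : Fin n → EuclideanSpace ℝ (Fin d)) : 0 ≤ sqDist x y :=
  Finset.sum_nonneg fun _ _ => sq_nonneg _

lemma sum_sub_avg (hn : 0 < n) {E : Type*} [AddCommGroup E] [Module ℝ E] (x : Fin n → E) :
    ∑ i, (x i - avg x) = 0 := by
  have : (n : ℝ) ≠ 0 := by positivity
  rw [Finset.sum_sub_distrib, Finset.sum_const, Finset.card_univ, Fintype.card_fin, avg,
    ← Nat.cast_smul_eq_nsmul ℝ, smul_smul, mul_one_div_cancel this, one_smul, sub_self]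

lemma avg_add {E : Type*} [AddCommGroup E] [Module ℝ E] (x y : Fin n → E) :
    avg (fun i => x i + y i) = avg x + avg y := by
  simp [avg, Finset.sum_add_distrib]

lemma avg_sub {E : Type*} [AddCommGroup E] [Module ℝ E] (x y : Fin n → E) :
    avg (fun i => x i - y i) = avg x - avg y := by
  simp [avg, Finset.sum_sub_distrib, smul_sub]

lemma avg_smul {E : Type*} [AddCommGroup E] [Module ℝ E] (a : ℝ) (x : Fin n → E) :
    avg (fun i => a • x i) = a • avg x := by
  simp only [avg, ← Finset.smul_sum, smul_comm a]

lemma avg_const (hn : 0 < n) {E : Type*} [AddCommGroup E] [Module ℝ E] (v : E) :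
    avg (fun _ : Fin n => v) = v := by
  have : (n : ℝ) ≠ 0 := by positivity
  rw [avg, Finset.sum_const, Finset.card_univ, Fintype.card_fin,
    ← Nat.cast_smul_eq_nsmul ℝ, smul_smul, one_div_mul_cancel this, one_smul]

lemma sum_gossip (hds : W ∈ doublyStochastic ℝ (Fin n)) {E : Type*} [AddCommGroup E]
    [Module ℝ E] (x : Fin n → E) : ∑ i, gossip W x i = 0 := by
  simp only [gossip, smul_sub, Finset.sum_sub_distrib, ← Finset.sum_smul,
    sum_row_of_mem_doublyStochastic hds, one_smul]
  rw [Finset.sum_comm]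
  simp only [← Finset.sum_smul, sum_col_of_mem_doublyStochastic hds, one_smul, sub_self]

lemma gossip_sub {E : Type*} [AddCommGroup E] [Module ℝ E] (x y : Fin n → E) (i : Fin n) :
    gossip W (fun i => x i - y i) i = gossip W x i - gossip W y i := by
  rw [gossip, gossip, gossip, ← Finset.sum_sub_distrib]
  exact Finset.sum_congr rfl fun j _ => by rw [← smul_sub]; congr 1; abel

lemma gossip_sub_const {E : Type*} [AddCommGroup E] [Module ℝ E] (x : Fin n → E) (v : E)
    (i : Fin n) : gossip W (fun i => x i - v) i = gossip W x i := by
  simp [gossip]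

lemma avg_add_smul_gossip (hds : W ∈ doublyStochastic ℝ (Fin n)) (γ : ℝ)
    {E : Type*} [AddCommGroup E] [Module ℝ E] (x y : Fin n → E) :
    avg (fun i => x i + γ • gossip W y i) = avg x := by
  rw [avg_add, avg_smul]
  simp [avg, sum_gossip hds]

lemma sum_norm_sq_eq (z : Fin n → EuclideanSpace ℝ (Fin d)) :
    ∑ i, ‖z i‖ ^ 2 = ∑ k, ∑ i, z i k ^ 2 := by
  rw [Finset.sum_comm]
  exact Finset.sum_congr rfl fun i _ => EuclideanSpace.real_norm_sq_eq _

lemma gossip_apply (x : Fin n → EuclideanSpace ℝ (Fin d)) (i : Fin n) (k : Fin d) :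
    gossip W x i k = gossip W (fun i => x i k) i := by
  simp [gossip]

/-- A gossip step with estimates `y` of the parameters `x` contracts the disagreement and does not
blow up the error of the estimates by more than a factor which compression compensates. -/
lemma disagreement_add_sqDist_gossip_le (hn : 0 < n) (hW : W.IsHermitian)
    (hds : W ∈ doublyStochastic ℝ (Fin n)) (h2 : secondAbsEigenvalue hW < 1) {γ ω : ℝ}
    (hγ : IsConsensusStep γ (spectralGap hW) (beta hW) ω)
    (x y : Fin n → EuclideanSpace ℝ (Fin d)) :
    disagreement (fun i => x i + γ • gossip W y i)
      + sqDist (fun i => x i + γ • gossip W y i) y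
      ≤ (1 - 3 / 8 * (γ * spectralGap hW)) * disagreement x + (1 + 3 / 4 * ω) * sqDist x y := by
  rw [disagreement, disagreement, sqDist, sqDist, avg_add_smul_gossip hds]
  have hg : ∀ i, gossip W y i
      = gossip W (fun i => x i - avg x) i - gossip W (fun i => x i - y i) i := by
    intro i
    rw [gossip_sub_const, gossip_sub]; abel
  have e1 : ∀ i k, (x i + γ • gossip W y i - avg x) k = (x i - avg x) k
      + γ * gossip W (fun i => (x i - avg x) k) i - γ * gossip W (fun i => (x i - y i) k) i := by
    intro i k
    rw [hg, ← gossip_apply (fun i => x i - avg x), ← gossip_apply (fun i => x i - y i)]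
    simp only [PiLp.sub_apply, PiLp.add_apply, PiLp.smul_apply, smul_eq_mul]
    ring
  have e2 : ∀ i k, (x i + γ • gossip W y i - y i) k = (x i - y i) k
      + γ * gossip W (fun i => (x i - avg x) k) i - γ * gossip W (fun i => (x i - y i) k) i := by
    intro i k
    rw [hg, ← gossip_apply (fun i => x i - avg x), ← gossip_apply (fun i => x i - y i)]
    simp only [PiLp.sub_apply, PiLp.add_apply, PiLp.smul_apply, smul_eq_mul]
    ring
  rw [sum_norm_sq_eq, sum_norm_sq_eq, sum_norm_sq_eq, sum_norm_sq_eq,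
    ← Finset.sum_add_distrib, Finset.mul_sum, Finset.mul_sum, ← Finset.sum_add_distrib]
  refine Finset.sum_le_sum fun k _ => ?_
  simp only [e1, e2]
  refine sum_sq_gossip_step_le hn hW hds h2 hγ _ _ ?_
  have := congrArg (fun v : EuclideanSpace ℝ (Fin d) => v k) (sum_sub_avg hn x)
  simpa using this

end Gossip

section Perturbation

variable {n d : ℕ}

/-- The average minimizes the sum of the squared distances. -/
lemma disagreement_le_sum_norm_sub_sq (hn : 0 < n) (x : Fin n → EuclideanSpace ℝ (Fin d))
    (v : EuclideanSpace ℝ (Fin d)) : disagreement x ≤ ∑ i, ‖x i - v‖ ^ 2 := by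
  have h : ∑ i, ‖x i - v‖ ^ 2 = disagreement x + n * ‖avg x - v‖ ^ 2 := by
    have h1 : ∀ i, ‖x i - v‖ ^ 2
        = ‖x i - avg x‖ ^ 2 + 2 * inner ℝ (x i - avg x) (avg x - v) + ‖avg x - v‖ ^ 2 := by
      intro i
      rw [← norm_add_sq_real, sub_add_sub_cancel]
    simp only [h1, Finset.sum_add_distrib, ← Finset.mul_sum, ← sum_inner, sum_sub_avg hn]
    simp [disagreement]
  rw [h]
  have : 0 ≤ (n : ℝ) * ‖avg x - v‖ ^ 2 := by positivity
  linarith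

lemma disagreement_add_le (hn : 0 < n) {p : ℝ} (hp : 0 < p)
    (x y : Fin n → EuclideanSpace ℝ (Fin d)) :
    disagreement (fun i => x i + y i)
      ≤ (1 + p) * disagreement x + (1 + 1 / p) * ∑ i, ‖y i‖ ^ 2 := by
  have h1 : disagreement (fun i => x i + y i)
      ≤ (1 + p) * disagreement x + (1 + 1 / p) * disagreement y := by
    rw [disagreement, disagreement, disagreement, Finset.mul_sum, Finset.mul_sum,
      ← Finset.sum_add_distrib]
    refine Finset.sum_le_sum fun i _ => ?_
    rw [avg_add, add_sub_add_comm]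
    exact norm_add_sq_le_weighted hp _ _
  have h2 := disagreement_le_sum_norm_sub_sq hn y 0
  simp only [sub_zero] at h2
  exact h1.trans (by gcongr)

lemma sqDist_add_le {p : ℝ} (hp : 0 < p) (x y z : Fin n → EuclideanSpace ℝ (Fin d)) :
    sqDist (fun i => x i + y i) z ≤ (1 + p) * sqDist x z + (1 + 1 / p) * ∑ i, ‖y i‖ ^ 2 := by
  rw [sqDist, sqDist, Finset.mul_sum, Finset.mul_sum, ← Finset.sum_add_distrib]
  refine Finset.sum_le_sum fun i _ => ?_
  rw [add_sub_right_comm]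
  exact norm_add_sq_le_weighted hp _ _

end Perturbation

/-! ### Averaging over fresh randomness -/

section Fubini

variable {Ω α β : Type*} [MeasurableSpace Ω] [MeasurableSpace α] [MeasurableSpace β]
  {P : Measure Ω} [IsProbabilityMeasure P] {D : Measure β} {X : Ω → α} {Y : Ω → β}

/-- If `Y` is independent of `X` and the `Y`-average of `φ` is at most `ψ`, then
`E φ(X, Y) ≤ E ψ(X)`; integrability is part of the conclusion. -/
lemma integral_le_of_indepFun (hX : Measurable X) (hY : Measurable Y) (hXY : IndepFun X Y P)
    (hD : P.map Y = D) {φ : α → β → ℝ} {ψ : α → ℝ} (hφ : Measurable (Function.uncurry φ))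
    (hφ0 : ∀ x y, 0 ≤ φ x y) (hint : ∀ x, Integrable (φ x) D) (hle : ∀ x, ∫ y, φ x y ∂D ≤ ψ x)
    (hψm : Measurable ψ) (hψ : Integrable (fun w => ψ (X w)) P) :
    Integrable (fun w => φ (X w) (Y w)) P ∧ ∫ w, φ (X w) (Y w) ∂P ≤ ∫ w, ψ (X w) ∂P := by
  have hlaw := (indepFun_iff_map_prod_eq_prod_map_map hX.aemeasurable hY.aemeasurable).1 hXY
  have : IsProbabilityMeasure D := hD ▸ Measure.isProbabilityMeasure_map hY.aemeasurable
  have : IsProbabilityMeasure (P.map X) := Measure.isProbabilityMeasure_map hX.aemeasurable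
  rw [hD] at hlaw
  have hXYm : Measurable fun w => (X w, Y w) := hX.prodMk hY
  have hψ' : Integrable ψ (P.map X) :=
    (integrable_map_measure hψm.aestronglyMeasurable hX.aemeasurable).2 hψ
  have hφi : Integrable (Function.uncurry φ) ((P.map X).prod D) := by
    rw [integrable_prod_iff hφ.aestronglyMeasurable]
    refine ⟨Filter.Eventually.of_forall fun x => hint x, hψ'.mono' ?_ ?_⟩
    · exact (hφ.aestronglyMeasurable (μ := (P.map X).prod D)).norm.integral_prod_right'
    · refine Filter.Eventually.of_forall fun x => ?_
      simp only [Function.uncurry, Real.norm_eq_abs, abs_of_nonneg (hφ0 _ _)]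
      rw [abs_of_nonneg (integral_nonneg fun y => hφ0 x y)]
      exact hle x
  constructor
  · rw [← hlaw] at hφi
    exact (integrable_map_measure hφ.aestronglyMeasurable hXYm.aemeasurable).1 hφi
  · calc ∫ w, φ (X w) (Y w) ∂P = ∫ q, Function.uncurry φ q ∂(P.map fun w => (X w, Y w)) :=
          (integral_map hXYm.aemeasurable hφ.aestronglyMeasurable).symm
      _ = ∫ x, ∫ y, φ x y ∂D ∂(P.map X) := by rw [hlaw, integral_prod _ hφi]; rfl
      _ ≤ ∫ x, ψ x ∂(P.map X) := integral_mono hφi.integral_prod_left hψ' hle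
      _ = _ := integral_map hX.aemeasurable hψm.aestronglyMeasurable

/-- A function with vanishing `Y`-averages has expectation zero at `(X, Y)` if `Y` is independent
of `X`. -/
lemma integral_eq_zero_of_indepFun (hX : Measurable X) (hY : Measurable Y)
    (hXY : IndepFun X Y P) (hD : P.map Y = D) {φ : α → β → ℝ}
    (hφ : Measurable (Function.uncurry φ)) (hint : Integrable (fun w => φ (X w) (Y w)) P)
    (h0 : ∀ x, ∫ y, φ x y ∂D = 0) : ∫ w, φ (X w) (Y w) ∂P = 0 := by
  have hlaw := (indepFun_iff_map_prod_eq_prod_map_map hX.aemeasurable hY.aemeasurable).1 hXY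
  have : IsProbabilityMeasure D := hD ▸ Measure.isProbabilityMeasure_map hY.aemeasurable
  have : IsProbabilityMeasure (P.map X) := Measure.isProbabilityMeasure_map hX.aemeasurable
  rw [hD] at hlaw
  have hXYm : Measurable fun w => (X w, Y w) := hX.prodMk hY
  have hφi : Integrable (Function.uncurry φ) ((P.map X).prod D) := by
    rw [← hlaw]
    exact (integrable_map_measure hφ.aestronglyMeasurable hXYm.aemeasurable).2 hint
  calc ∫ w, φ (X w) (Y w) ∂P = ∫ q, Function.uncurry φ q ∂(P.map fun w => (X w, Y w)) :=
        (integral_map hXYm.aemeasurable hφ.aestronglyMeasurable).symm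
    _ = ∫ x, ∫ y, φ x y ∂D ∂(P.map X) := by rw [hlaw, integral_prod _ hφi]; rfl
    _ = 0 := by simp [h0]

end Fubini

section StochasticGradient

variable {d : ℕ} {Ξ : Type*} [MeasurableSpace Ξ] {D : Measure Ξ}
  {f : EuclideanSpace ℝ (Fin d) → ℝ}
  {g : EuclideanSpace ℝ (Fin d) → Ξ → EuclideanSpace ℝ (Fin d)}
  {G σ L : ℝ}

lemma integrable_inner_of_memLp {Ω E : Type*} [MeasurableSpace Ω] {P : Measure Ω}
    [NormedAddCommGroup E] [InnerProductSpace ℝ E] {U V : Ω → E} (hU : MemLp U 2 P)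
    (hV : MemLp V 2 P) : Integrable (fun w => (inner ℝ (U w) (V w) : ℝ)) P :=
  (hU.norm.integrable_mul hV.norm).mono' (hU.1.inner hV.1)
    (Filter.Eventually.of_forall fun w => norm_inner_le_norm (U w) (V w))

lemma LSmooth.lipschitzWith (hf : LSmooth L f) : LipschitzWith L.toNNReal (gradient f) :=
  LipschitzWith.of_dist_le_mul fun x y => by
    rw [dist_eq_norm, dist_eq_norm]
    exact (hf.2 x y).trans (by gcongr; exact Real.le_coe_toNNReal L)

lemma IsStochasticGradient.memLp (hg : IsStochasticGradient D f g G σ)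
    (x : EuclideanSpace ℝ (Fin d)) : MemLp (g x) 2 D :=
  (memLp_two_iff_integrable_sq_norm
    (hg.measurable.of_uncurry_left).aestronglyMeasurable).2 (hg.integrable_sq x)

variable {Ω : Type*} [MeasurableSpace Ω] {P : Measure Ω} [IsProbabilityMeasure P]
  {X V : Ω → EuclideanSpace ℝ (Fin d)} {Y : Ω → Ξ}

lemma IsStochasticGradient.integral_norm_sq_le (hg : IsStochasticGradient D f g G σ)
    (hX : Measurable X) (hY : Measurable Y) (hXY : IndepFun X Y P) (hD : P.map Y = D) :
    MemLp (fun w => g (X w) (Y w)) 2 P ∧ ∫ w, ‖g (X w) (Y w)‖ ^ 2 ∂P ≤ G ^ 2 := by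
  have h := integral_le_of_indepFun (φ := fun x y => ‖g x y‖ ^ 2) (ψ := fun _ => G ^ 2)
    hX hY hXY hD (hg.measurable.norm.pow_const 2) (fun _ _ => sq_nonneg _) hg.integrable_sq
    hg.second_moment_le measurable_const (integrable_const _)
  refine ⟨(memLp_two_iff_integrable_sq_norm ?_).2 h.1, by simpa using h.2⟩
  exact (hg.measurable.comp (hX.prodMk hY)).aestronglyMeasurable

lemma IsStochasticGradient.integral_noise_sq_le (hg : IsStochasticGradient D f g G σ)
    (hf : LSmooth L f)
    (hX : Measurable X) (hY : Measurable Y) (hXY : IndepFun X Y P) (hD : P.map Y = D) :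
    MemLp (fun w => g (X w) (Y w) - gradient f (X w)) 2 P ∧
      ∫ w, ‖g (X w) (Y w) - gradient f (X w)‖ ^ 2 ∂P ≤ σ ^ 2 := by
  have : IsProbabilityMeasure D := hD ▸ Measure.isProbabilityMeasure_map hY.aemeasurable
  have hgm : Measurable (gradient f) := hf.lipschitzWith.continuous.measurable
  have hm : Measurable (Function.uncurry fun x y => g x y - gradient f x) :=
    hg.measurable.sub (hgm.comp measurable_fst)
  have h := integral_le_of_indepFun (φ := fun x y => ‖g x y - gradient f x‖ ^ 2)
    (ψ := fun _ => σ ^ 2)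
    hX hY hXY hD (hm.norm.pow_const 2) (fun _ _ => sq_nonneg _)
    (fun x => ((hg.memLp x).sub (memLp_const (gradient f x))).integrable_norm_pow two_ne_zero)
    hg.variance_le measurable_const (integrable_const _)
  refine ⟨(memLp_two_iff_integrable_sq_norm ?_).2 h.1, by simpa using h.2⟩
  exact (hm.comp (hX.prodMk hY)).aestronglyMeasurable

/-- The gradient noise is orthogonal to everything independent of the fresh sample. -/
lemma IsStochasticGradient.integral_inner_noise (hg : IsStochasticGradient D f g G σ)
    (hf : LSmooth L f) (hX : Measurable X) (hVm : Measurable V) (hV : MemLp V 2 P)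
    (hY : Measurable Y) (hXY : IndepFun (fun w => (V w, X w)) Y P) (hD : P.map Y = D) :
    ∫ w, inner ℝ (V w) (g (X w) (Y w) - gradient f (X w)) ∂P = 0 := by
  have : IsProbabilityMeasure D := hD ▸ Measure.isProbabilityMeasure_map hY.aemeasurable
  have hgm : Measurable (gradient f) := hf.lipschitzWith.continuous.measurable
  have hm : Measurable (Function.uncurry fun x y => g x y - gradient f x) :=
    hg.measurable.sub (hgm.comp measurable_fst)
  have hXY' : IndepFun X Y P := hXY.comp measurable_snd measurable_id
  refine integral_eq_zero_of_indepFun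
    (φ := fun (q : EuclideanSpace ℝ (Fin d) × EuclideanSpace ℝ (Fin d)) y =>
      inner ℝ q.1 (g q.2 y - gradient f q.2))
    (hVm.prodMk hX) hY hXY hD ?_ ?_ ?_
  · exact (measurable_fst.comp measurable_fst).inner
      (hm.comp ((measurable_snd.comp measurable_fst).prodMk measurable_snd))
  · exact integrable_inner_of_memLp hV (hg.integral_noise_sq_le hf hX hY hXY' hD).1
  · rintro ⟨v, x⟩
    have hi : Integrable (g x) D := (hg.memLp x).integrable one_le_two
    have := integral_inner (𝕜 := ℝ) (hi.sub (integrable_const (gradient f x))) v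
    rw [integral_sub' hi (integrable_const _), hg.unbiased] at this
    simpa using this

end StochasticGradient

section Compression

variable {d : ℕ} {Z : Type*} [MeasurableSpace Z] {ν : Measure Z} [IsProbabilityMeasure ν]
  {C : EuclideanSpace ℝ (Fin d) → Z → EuclideanSpace ℝ (Fin d)} {ω : ℝ}

open Classical in
/-- The event-triggered compression: nothing is sent unless `‖v‖ ^ 2` exceeds the threshold `θ`. -/
noncomputable def triggered (C : EuclideanSpace ℝ (Fin d) → Z → EuclideanSpace ℝ (Fin d)) (θ : ℝ)
    (v : EuclideanSpace ℝ (Fin d)) (z : Z) : EuclideanSpace ℝ (Fin d) :=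
  if θ < ‖v‖ ^ 2 then C v z else 0

lemma measurable_triggered (hC : Measurable (Function.uncurry C)) (θ : ℝ) :
    Measurable (Function.uncurry (triggered C θ)) := by
  classical
  refine Measurable.ite ?_ hC measurable_const
  exact measurableSet_lt measurable_const (measurable_fst.norm.pow_const 2)

variable {Ω : Type*} [MeasurableSpace Ω] {P : Measure Ω} [IsProbabilityMeasure P]
  {U : Ω → EuclideanSpace ℝ (Fin d)} {Y : Ω → Z}

/-- An untriggered node has an error of at most `θ ≤ τ`, of which the fraction `1 - ω` is accounted
for by the contraction of the compressor. -/
lemma IsCompression.integral_triggered_le (hC : IsCompression ν C ω) (hω : 0 < ω)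
    {θ τ : ℝ} (hθ : θ ≤ τ) (hτ : 0 ≤ τ) (hUm : Measurable U) (hU : MemLp U 2 P)
    (hY : Measurable Y) (hUY : IndepFun U Y P) (hν : P.map Y = ν) :
    MemLp (fun w => triggered C θ (U w) (Y w) - U w) 2 P ∧
      ∫ w, ‖triggered C θ (U w) (Y w) - U w‖ ^ 2 ∂P
        ≤ (1 - ω) * ∫ w, ‖U w‖ ^ 2 ∂P + ω * τ := by
  have hm : Measurable (Function.uncurry fun x y => triggered C θ x y - x) :=
    (measurable_triggered hC.measurable θ).sub measurable_fst
  have hU2 : Integrable (fun w => ‖U w‖ ^ 2) P := hU.integrable_norm_pow two_ne_zero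
  have h := integral_le_of_indepFun (φ := fun x y => ‖triggered C θ x y - x‖ ^ 2)
    (ψ := fun x => (1 - ω) * ‖x‖ ^ 2 + ω * τ)
    hUm hY hUY hν (hm.norm.pow_const 2) (fun _ _ => sq_nonneg _) ?_ ?_
    (by fun_prop) ((hU2.const_mul _).add (integrable_const _))
  · refine ⟨(memLp_two_iff_integrable_sq_norm ?_).2 h.1, h.2.trans_eq ?_⟩
    · exact (hm.comp (hUm.prodMk hY)).aestronglyMeasurable
    · rw [integral_add (hU2.const_mul _) (integrable_const _), integral_const_mul]
      simp
  · intro x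
    by_cases hx : θ < ‖x‖ ^ 2
    · simpa only [triggered, if_pos hx] using hC.integrable_sq x
    · simp only [triggered, if_neg hx]; exact integrable_const _
  · intro x
    by_cases hx : θ < ‖x‖ ^ 2
    · simp only [triggered, if_pos hx]
      exact (hC.contraction x).trans (le_add_of_nonneg_right (by positivity))
    · simp only [triggered, if_neg hx]
      simp only [zero_sub, norm_neg, integral_const, probReal_univ, smul_eq_mul, one_mul]
      nlinarith [mul_le_mul_of_nonneg_left ((not_lt.1 hx).trans hθ) hω.le]

end Compression

/-! ### The stochastic process: measurability, independence, second moments -/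

lemma newEstimate_eq_add_triggered {n d : ℕ} {Z : Type*}
    (C : EuclideanSpace ℝ (Fin d) → Z → EuclideanSpace ℝ (Fin d)) (η θ : ℝ)
    (grad : Fin n → EuclideanSpace ℝ (Fin d)) (z : Fin n → Z) (S : State n d) (i : Fin n) :
    newEstimate η θ grad (fun i v => C v (z i)) S i =
      S.xhat i + triggered C (θ * η ^ 2) (halfStep η grad S i - S.xhat i) (z i) := by
  by_cases hθ : θ * η ^ 2 < ‖halfStep η grad S i - S.xhat i‖ ^ 2
  · simp only [newEstimate, triggered, if_pos hθ]
  · simp only [newEstimate, triggered, if_neg hθ, add_zero]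

section Trajectory

variable {n d : ℕ} {Ξ : Fin n → Type*} {Z : Type*}
  {g : (i : Fin n) → EuclideanSpace ℝ (Fin d) → Ξ i → EuclideanSpace ℝ (Fin d)}
  {C : EuclideanSpace ℝ (Fin d) → Z → EuclideanSpace ℝ (Fin d)}
  {W : Matrix (Fin n) (Fin n) ℝ} {γ η : ℝ} {c : ℕ → ℝ} {I : Finset ℕ}
  {Ω : Type*} {ξ : (i : Fin n) → ℕ → Ω → Ξ i} {ζ : Fin n → ℕ → Ω → Z}
  {x₀ : EuclideanSpace ℝ (Fin d)} {x y : ℕ → Fin n → Ω → EuclideanSpace ℝ (Fin d)}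

/-- The stochastic gradient which node `i` uses at time `t`. -/
def sampledGrad (g : (i : Fin n) → EuclideanSpace ℝ (Fin d) → Ξ i → EuclideanSpace ℝ (Fin d))
    (ξ : (i : Fin n) → ℕ → Ω → Ξ i) (x : ℕ → Fin n → Ω → EuclideanSpace ℝ (Fin d))
    (t : ℕ) (i : Fin n) (w : Ω) : EuclideanSpace ℝ (Fin d) :=
  g i (x t i w) (ξ i t w)

/-- The random variables `x t i` (parameters) and `y t i` (estimates) follow SPARQ-SGD with constant
step size `η`, samples `ξ` and compression seeds `ζ`. -/
structure IsTrajectory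
    (g : (i : Fin n) → EuclideanSpace ℝ (Fin d) → Ξ i → EuclideanSpace ℝ (Fin d))
    (C : EuclideanSpace ℝ (Fin d) → Z → EuclideanSpace ℝ (Fin d))
    (W : Matrix (Fin n) (Fin n) ℝ) (γ η : ℝ) (c : ℕ → ℝ) (I : Finset ℕ)
    (ξ : (i : Fin n) → ℕ → Ω → Ξ i) (ζ : Fin n → ℕ → Ω → Z) (x₀ : EuclideanSpace ℝ (Fin d))
    (x y : ℕ → Fin n → Ω → EuclideanSpace ℝ (Fin d)) : Prop where
  x_zero : ∀ i w, x 0 i w = x₀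
  y_zero : ∀ i w, y 0 i w = x₀
  x_local : ∀ t, t + 1 ∉ I → ∀ i w, x (t + 1) i w = x t i w - η • sampledGrad g ξ x t i w
  y_local : ∀ t, t + 1 ∉ I → ∀ i w, y (t + 1) i w = y t i w
  y_sync : ∀ t, t + 1 ∈ I → ∀ i w, y (t + 1) i w = y t i w + triggered C (c t * η ^ 2)
    (x t i w - η • sampledGrad g ξ x t i w - y t i w) (ζ i t w)
  x_sync : ∀ t, t + 1 ∈ I → ∀ i w, x (t + 1) i w = x t i w - η • sampledGrad g ξ x t i w
    + γ • gossip W (fun j => y (t + 1) j w) i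

lemma isTrajectory_iterate : IsTrajectory g C W γ η c I ξ ζ x₀
    (fun t i w => (iterate W γ (fun _ => η) c I g C x₀
      (fun i s => ξ i s w) (fun i s => ζ i s w) t).x i)
    (fun t i w => (iterate W γ (fun _ => η) c I g C x₀
      (fun i s => ξ i s w) (fun i s => ζ i s w) t).xhat i) where
  x_zero _ _ := rfl
  y_zero _ _ := rfl
  x_local t ht i w := by simp only [iterate, if_neg ht]; rfl
  y_local t ht i w := by simp only [iterate, if_neg ht]; rfl
  y_sync t ht i w := by
    simp only [iterate, if_pos ht]
    exact newEstimate_eq_add_triggered C η (c t) _ (fun i => ζ i t w) _ i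
  x_sync t ht i w := by simp only [iterate, if_pos ht]; rfl

variable [∀ i, MeasurableSpace (Ξ i)] [MeasurableSpace Z]

/-- The state at time `t` is a function of the randomness before time `t`. The σ-algebra `m` is
arbitrary, so that independence of a fresh sample can be read off from it. -/
lemma IsTrajectory.measurable_state (h : IsTrajectory g C W γ η c I ξ ζ x₀ x y)
    (hg : ∀ i, Measurable (Function.uncurry (g i))) (hC : Measurable (Function.uncurry C))
    (m : MeasurableSpace Ω) (t : ℕ) (hξ : ∀ i, ∀ s < t, Measurable (ξ i s))
    (hζ : ∀ i, ∀ s < t, Measurable (ζ i s)) (i : Fin n) :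
    Measurable (x t i) ∧ Measurable (y t i) := by
  induction t generalizing i with
  | zero =>
    rw [show x 0 i = fun _ => x₀ from funext (h.x_zero i),
      show y 0 i = fun _ => x₀ from funext (h.y_zero i)]
    exact ⟨measurable_const, measurable_const⟩
  | succ t ih =>
    replace ih := ih (fun i s hs => hξ i s (hs.trans t.lt_succ_self))
      (fun i s hs => hζ i s (hs.trans t.lt_succ_self))
    have hgrad : ∀ i, Measurable (sampledGrad g ξ x t i) := fun i =>
      (hg i).comp ((ih i).1.prodMk (hξ i t t.lt_succ_self))
    have hhalf : ∀ i, Measurable fun w => x t i w - η • sampledGrad g ξ x t i w := fun i =>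
      (ih i).1.sub ((hgrad i).const_smul η)
    by_cases ht : t + 1 ∈ I
    · have hy : ∀ i, Measurable (y (t + 1) i) := fun i => by
        have h1 := ((hhalf i).sub (ih i).2).prodMk (hζ i t t.lt_succ_self)
        have h2 := (measurable_triggered hC (c t * η ^ 2)).comp h1
        rw [funext (h.y_sync t ht i)]
        exact (ih i).2.add h2
      refine ⟨?_, hy i⟩
      rw [funext (h.x_sync t ht i)]
      refine (hhalf i).add (Measurable.const_smul ?_ γ)
      exact Finset.measurable_sum _ fun j _ => ((hy j).sub (hy i)).const_smul (W i j)
    · rw [funext (h.x_local t ht i), funext (h.y_local t ht i)]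
      exact ⟨hhalf i, (ih i).2⟩

/-- The σ-algebra generated by all samples and seeds except the one with index `a`. -/
abbrev others (ξ : (i : Fin n) → ℕ → Ω → Ξ i) (ζ : Fin n → ℕ → Ω → Z)
    (a : Fin n × ℕ ⊕ Fin n × ℕ) : MeasurableSpace Ω :=
  ⨆ b ∈ ({a}ᶜ : Set (Fin n × ℕ ⊕ Fin n × ℕ)), Sum.elim
    (fun a : Fin n × ℕ => MeasurableSpace.comap (ξ a.1 a.2) inferInstance)
    (fun a : Fin n × ℕ => MeasurableSpace.comap (ζ a.1 a.2) inferInstance) b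

lemma measurable_sample_others {a : Fin n × ℕ ⊕ Fin n × ℕ} {i : Fin n} {t : ℕ}
    (ha : Sum.inl (i, t) ≠ a) : Measurable[others ξ ζ a] (ξ i t) := by
  rw [measurable_iff_comap_le]
  exact le_iSup₂_of_le (Sum.inl (i, t)) (by simpa using ha) le_rfl

lemma measurable_seed_others {a : Fin n × ℕ ⊕ Fin n × ℕ} {i : Fin n} {t : ℕ}
    (ha : Sum.inr (i, t) ≠ a) : Measurable[others ξ ζ a] (ζ i t) := by
  rw [measurable_iff_comap_le]
  exact le_iSup₂_of_le (Sum.inr (i, t)) (by simpa using ha) le_rfl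

variable [MeasurableSpace Ω] {P : Measure Ω} {D : (i : Fin n) → Measure (Ξ i)} {ν : Measure Z}
  {f : Fin n → EuclideanSpace ℝ (Fin d) → ℝ} {L G : ℝ} {σ : Fin n → ℝ} {ω : ℝ}

/-- A trajectory of SPARQ-SGD whose data satisfy the standing assumptions. -/
structure IsRun (P : Measure Ω) (D : (i : Fin n) → Measure (Ξ i)) (ν : Measure Z)
    (f : Fin n → EuclideanSpace ℝ (Fin d) → ℝ)
    (g : (i : Fin n) → EuclideanSpace ℝ (Fin d) → Ξ i → EuclideanSpace ℝ (Fin d))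
    (L G : ℝ) (σ : Fin n → ℝ) (C : EuclideanSpace ℝ (Fin d) → Z → EuclideanSpace ℝ (Fin d)) (ω : ℝ)
    (W : Matrix (Fin n) (Fin n) ℝ) (γ η : ℝ) (c : ℕ → ℝ) (I : Finset ℕ)
    (ξ : (i : Fin n) → ℕ → Ω → Ξ i) (ζ : Fin n → ℕ → Ω → Z) (x₀ : EuclideanSpace ℝ (Fin d))
    (x y : ℕ → Fin n → Ω → EuclideanSpace ℝ (Fin d)) : Prop
    extends IsTrajectory g C W γ η c I ξ ζ x₀ x y where
  sampling : IsSampling P D ν ξ ζ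
  smooth : ∀ i, LSmooth L (f i)
  stochasticGradient : ∀ i, IsStochasticGradient (D i) (f i) (g i) G (σ i)
  compression : IsCompression ν C ω

namespace IsRun

lemma indep_others (h : IsRun P D ν f g L G σ C ω W γ η c I ξ ζ x₀ x y)
    (a : Fin n × ℕ ⊕ Fin n × ℕ) :
    Indep (others ξ ζ a) (Sum.elim
      (fun a : Fin n × ℕ => MeasurableSpace.comap (ξ a.1 a.2) inferInstance)
      (fun a : Fin n × ℕ => MeasurableSpace.comap (ζ a.1 a.2) inferInstance) a) P := by
  have h1 := indep_iSup_of_disjoint (S := {a}ᶜ) (T := {a}) (fun b => ?_) h.sampling.indep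
    (by simp)
  · simpa only [Set.mem_singleton_iff, iSup_iSup_eq_left] using h1
  · rcases b with b | b
    · exact (h.sampling.measurable_sample b.1 b.2).comap_le
    · exact (h.sampling.measurable_seed b.1 b.2).comap_le

lemma indepFun_sample (h : IsRun P D ν f g L G σ C ω W γ η c I ξ ζ x₀ x y) {β : Type*}
    [MeasurableSpace β] {U : Ω → β} {i : Fin n} {t : ℕ}
    (hU : Measurable[others ξ ζ (Sum.inl (i, t))] U) : IndepFun U (ξ i t) P :=
  indep_of_indep_of_le_left (h.indep_others (Sum.inl (i, t))) hU.comap_le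

lemma indepFun_seed (h : IsRun P D ν f g L G σ C ω W γ η c I ξ ζ x₀ x y) {β : Type*}
    [MeasurableSpace β] {U : Ω → β} {i : Fin n} {t : ℕ}
    (hU : Measurable[others ξ ζ (Sum.inr (i, t))] U) : IndepFun U (ζ i t) P :=
  indep_of_indep_of_le_left (h.indep_others (Sum.inr (i, t))) hU.comap_le

lemma measurable_state_others_sample (h : IsRun P D ν f g L G σ C ω W γ η c I ξ ζ x₀ x y)
    (i j : Fin n) (t : ℕ) : Measurable[others ξ ζ (Sum.inl (i, t))] (x t j) :=
  (h.toIsTrajectory.measurable_state (fun i => (h.stochasticGradient i).measurable)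
    h.compression.measurable _ t (fun k s hs => measurable_sample_others (by simp [hs.ne]))
    (fun k s _ => measurable_seed_others (by simp)) j).1

lemma measurable_x (h : IsRun P D ν f g L G σ C ω W γ η c I ξ ζ x₀ x y) (t : ℕ) (i : Fin n) :
    Measurable (x t i) :=
  (h.toIsTrajectory.measurable_state (fun i => (h.stochasticGradient i).measurable)
    h.compression.measurable _ t (fun j s _ => h.sampling.measurable_sample j s)
    (fun j s _ => h.sampling.measurable_seed j s) i).1

lemma measurable_y (h : IsRun P D ν f g L G σ C ω W γ η c I ξ ζ x₀ x y) (t : ℕ) (i : Fin n) :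
    Measurable (y t i) :=
  (h.toIsTrajectory.measurable_state (fun i => (h.stochasticGradient i).measurable)
    h.compression.measurable _ t (fun j s _ => h.sampling.measurable_sample j s)
    (fun j s _ => h.sampling.measurable_seed j s) i).2

lemma measurable_half (h : IsRun P D ν f g L G σ C ω W γ η c I ξ ζ x₀ x y) (t : ℕ) (i : Fin n) :
    Measurable fun w => x t i w - η • sampledGrad g ξ x t i w :=
  (h.measurable_x t i).sub (((h.stochasticGradient i).measurable.comp
    ((h.measurable_x t i).prodMk (h.sampling.measurable_sample i t))).const_smul η)

/-- The difference that a node may compress at time `t` is independent of the seed of the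
compressor. -/
lemma indepFun_half_sub_seed (h : IsRun P D ν f g L G σ C ω W γ η c I ξ ζ x₀ x y) (t : ℕ)
    (i : Fin n) :
    IndepFun (fun w => x t i w - η • sampledGrad g ξ x t i w - y t i w) (ζ i t) P := by
  have hst := h.toIsTrajectory.measurable_state
    (fun i => (h.stochasticGradient i).measurable) h.compression.measurable (others ξ ζ (Sum.inr (i, t))) t
    (fun k s _ => measurable_sample_others (by simp))
    (fun k s hs => measurable_seed_others (by simp [hs.ne])) i
  have hξ : Measurable[others ξ ζ (Sum.inr (i, t))] (ξ i t) := measurable_sample_others (by simp)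
  refine h.indepFun_seed ((hst.1.sub (Measurable.const_smul ?_ η)).sub hst.2)
  exact (h.stochasticGradient i).measurable.comp (hst.1.prodMk hξ)

variable [IsProbabilityMeasure P]

lemma sampledGrad_memLp (h : IsRun P D ν f g L G σ C ω W γ η c I ξ ζ x₀ x y) (t : ℕ)
    (i : Fin n) : MemLp (sampledGrad g ξ x t i) 2 P ∧
      ∫ w, ‖sampledGrad g ξ x t i w‖ ^ 2 ∂P ≤ G ^ 2 :=
  (h.stochasticGradient i).integral_norm_sq_le (h.measurable_x t i)
    (h.sampling.measurable_sample i t)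
    (h.indepFun_sample (h.measurable_state_others_sample i i t)) (h.sampling.law_sample i t)

lemma half_sub_memLp (h : IsRun P D ν f g L G σ C ω W γ η c I ξ ζ x₀ x y) {t : ℕ} {i : Fin n}
    (hx : MemLp (x t i) 2 P) : MemLp (fun w => x t i w - η • sampledGrad g ξ x t i w) 2 P :=
  hx.sub ((h.sampledGrad_memLp t i).1.const_smul η)

/-- The error of the estimate after a synchronization, before the gossip step. -/
lemma integral_estimate_error_le (h : IsRun P D ν f g L G σ C ω W γ η c I ξ ζ x₀ x y)
    (hω : 0 < ω) {t : ℕ} (ht : t + 1 ∈ I) {i : Fin n} {τ : ℝ} (hτ : 0 ≤ τ) (hc : c t * η ^ 2 ≤ τ)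
    (hx : MemLp (x t i) 2 P) (hy : MemLp (y t i) 2 P) :
    MemLp (fun w => x t i w - η • sampledGrad g ξ x t i w - y (t + 1) i w) 2 P ∧
      ∫ w, ‖x t i w - η • sampledGrad g ξ x t i w - y (t + 1) i w‖ ^ 2 ∂P
        ≤ (1 - ω) * ∫ w, ‖x t i w - η • sampledGrad g ξ x t i w - y t i w‖ ^ 2 ∂P + ω * τ := by
  have : IsProbabilityMeasure ν := by
    rw [← h.sampling.law_seed i t]
    exact Measure.isProbabilityMeasure_map (h.sampling.measurable_seed i t).aemeasurable
  have h1 := h.compression.integral_triggered_le hω hc hτ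
    ((h.measurable_half t i).sub (h.measurable_y t i)) ((h.half_sub_memLp hx).sub hy)
    (h.sampling.measurable_seed i t) (h.indepFun_half_sub_seed t i) (h.sampling.law_seed i t)
  have e : ∀ w, x t i w - η • sampledGrad g ξ x t i w - y (t + 1) i w
      = -(triggered C (c t * η ^ 2) (x t i w - η • sampledGrad g ξ x t i w - y t i w) (ζ i t w)
        - (x t i w - η • sampledGrad g ξ x t i w - y t i w)) := by
    intro w; rw [h.y_sync t ht]; abel
  simp only [e, norm_neg]
  exact ⟨h1.1.neg, h1.2⟩

lemma memLp_state (h : IsRun P D ν f g L G σ C ω W γ η c I ξ ζ x₀ x y) (hω : 0 < ω) (t : ℕ)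
    (i : Fin n) : MemLp (x t i) 2 P ∧ MemLp (y t i) 2 P := by
  induction t generalizing i with
  | zero =>
    rw [show x 0 i = fun _ => x₀ from funext (h.x_zero i),
      show y 0 i = fun _ => x₀ from funext (h.y_zero i)]
    exact ⟨memLp_const _, memLp_const _⟩
  | succ t ih =>
    have hhalf := fun i => h.half_sub_memLp (ih i).1
    by_cases ht : t + 1 ∈ I
    · have hy : ∀ i, MemLp (y (t + 1) i) 2 P := fun i => by
        have h1 := (h.integral_estimate_error_le hω ht (le_max_right (c t * η ^ 2) 0)
          (le_max_left _ _) (ih i).1 (ih i).2).1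
        have e : y (t + 1) i = fun w => x t i w - η • sampledGrad g ξ x t i w
            - (x t i w - η • sampledGrad g ξ x t i w - y (t + 1) i w) := by
          funext w; simp
        rw [e]
        exact (hhalf i).sub h1
      refine ⟨?_, hy i⟩
      rw [funext (h.x_sync t ht i)]
      refine (hhalf i).add (MemLp.const_smul ?_ γ)
      exact memLp_finsetSum _ fun j _ => ((hy j).sub (hy i)).const_smul (W i j)
    · rw [funext (h.x_local t ht i), funext (h.y_local t ht i)]
      exact ⟨hhalf i, (ih i).2⟩

end IsRun

end Trajectory

/-! ### The consensus bound -/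

section Consensus

variable {n d : ℕ} {Ξ : Fin n → Type*} {Z : Type*}
  {g : (i : Fin n) → EuclideanSpace ℝ (Fin d) → Ξ i → EuclideanSpace ℝ (Fin d)}
  {C : EuclideanSpace ℝ (Fin d) → Z → EuclideanSpace ℝ (Fin d)}
  {W : Matrix (Fin n) (Fin n) ℝ} {γ η : ℝ} {c : ℕ → ℝ} {I : Finset ℕ}
  {Ω : Type*} {ξ : (i : Fin n) → ℕ → Ω → Ξ i} {ζ : Fin n → ℕ → Ω → Z}
  {x₀ : EuclideanSpace ℝ (Fin d)} {x y : ℕ → Fin n → Ω → EuclideanSpace ℝ (Fin d)}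

/-- Between synchronizations the parameters drift by the accumulated gradients, and the estimates
stay put. -/
lemma IsTrajectory.state_of_no_sync (h : IsTrajectory g C W γ η c I ξ ζ x₀ x y) {s t : ℕ}
    (hst : s ≤ t) (hI : ∀ r, s < r → r ≤ t → r ∉ I) (i : Fin n) (w : Ω) :
    x t i w = x s i w - η • ∑ r ∈ Finset.Ico s t, sampledGrad g ξ x r i w ∧
      y t i w = y s i w := by
  induction t, hst using Nat.le_induction with
  | base => simp
  | succ t hst ih =>
    have ih := ih fun r h1 h2 => hI r h1 (h2.trans t.le_succ)
    have ht := hI (t + 1) (by omega) le_rfl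
    rw [h.x_local t ht, h.y_local t ht, Finset.sum_Ico_succ_top hst, ih.1, ih.2, smul_add]
    exact ⟨by abel, rfl⟩

/-- In a synchronization set, every positive time up to `T` is preceded by a synchronization at
distance at most `H`, without another one in between. -/
lemma IsSyncSet.exists_prev {T H : ℕ} (hI : IsSyncSet I T H) {t : ℕ} (ht : 0 < t) (htT : t ≤ T) :
    ∃ s ∈ I, s < t ∧ t - s ≤ H ∧ ∀ r, s < r → r < t → r ∉ I := by
  have hne : (I.filter (· < t)).Nonempty := ⟨0, by simp [hI.zero_mem, ht]⟩
  have hne' : (I.filter (t ≤ ·)).Nonempty := ⟨T, by simp [hI.last_mem, htT]⟩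
  set s := (I.filter (· < t)).max' hne with hs
  set s' := (I.filter (t ≤ ·)).min' hne' with hs'
  have h1 := Finset.max'_mem _ hne
  have h2 := Finset.min'_mem _ hne'
  rw [← hs, Finset.mem_filter] at h1
  rw [← hs', Finset.mem_filter] at h2
  have h3 : ∀ r ∈ I, r < t → r ≤ s := fun r hr hrt => Finset.le_max' _ _ (by simp [hr, hrt])
  have h4 : ∀ r ∈ I, t ≤ r → s' ≤ r := fun r hr hrt => Finset.min'_le _ _ (by simp [hr, hrt])
  have h5 := hI.gap_le s h1.1 s' h2.1 (h1.2.trans_le h2.2) fun r hr ⟨ha, hb⟩ => by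
    rcases lt_or_ge r t with h | h
    · exact absurd (h3 r hr h) (by omega)
    · exact absurd (h4 r hr h) (by omega)
  refine ⟨s, h1.1, h1.2, by omega, fun r hr hrt hrI => ?_⟩
  exact absurd (h3 r hrI hrt) (by omega)

variable [∀ i, MeasurableSpace (Ξ i)] [MeasurableSpace Z]
  [MeasurableSpace Ω] {P : Measure Ω} {D : (i : Fin n) → Measure (Ξ i)} {ν : Measure Z}
  {f : Fin n → EuclideanSpace ℝ (Fin d) → ℝ} {L G : ℝ} {σ : Fin n → ℝ} {ω : ℝ}

lemma memLp_avg {u : Fin n → Ω → EuclideanSpace ℝ (Fin d)} (hu : ∀ i, MemLp (u i) 2 P) :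
    MemLp (fun w => avg fun i => u i w) 2 P :=
  MemLp.const_smul (f := fun w => ∑ i, u i w) (memLp_finsetSum _ fun i _ => hu i) (1 / (n : ℝ))

lemma integrable_disagreement {u : Fin n → Ω → EuclideanSpace ℝ (Fin d)}
    (hu : ∀ i, MemLp (u i) 2 P) : Integrable (fun w => disagreement fun i => u i w) P :=
  integrable_finsetSum _ fun i _ => ((hu i).sub (memLp_avg hu)).integrable_norm_pow two_ne_zero

lemma integrable_sqDist {u v : Fin n → Ω → EuclideanSpace ℝ (Fin d)}
    (hu : ∀ i, MemLp (fun w => u i w - v i w) 2 P) :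
    Integrable (fun w => sqDist (fun i => u i w) (fun i => v i w)) P :=
  integrable_finsetSum _ fun i _ => (hu i).integrable_norm_pow two_ne_zero

namespace IsRun

variable [IsProbabilityMeasure P]

lemma integral_norm_sum_sampledGrad_sq_le (h : IsRun P D ν f g L G σ C ω W γ η c I ξ ζ x₀ x y)
    {H : ℕ} (s t : ℕ) (hH : t - s ≤ H) (i : Fin n) :
    MemLp (fun w => η • ∑ r ∈ Finset.Ico s t, sampledGrad g ξ x r i w) 2 P ∧
      ∫ w, ‖η • ∑ r ∈ Finset.Ico s t, sampledGrad g ξ x r i w‖ ^ 2 ∂P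
        ≤ η ^ 2 * H ^ 2 * G ^ 2 := by
  refine ⟨(memLp_finsetSum _ fun r _ => (h.sampledGrad_memLp r i).1).const_smul η, ?_⟩
  have hint : ∀ r, Integrable (fun w => ‖sampledGrad g ξ x r i w‖ ^ 2) P := fun r =>
    (h.sampledGrad_memLp r i).1.integrable_norm_pow two_ne_zero
  calc ∫ w, ‖η • ∑ r ∈ Finset.Ico s t, sampledGrad g ξ x r i w‖ ^ 2 ∂P
      ≤ ∫ w, η ^ 2 * ((t - s : ℕ) * ∑ r ∈ Finset.Ico s t, ‖sampledGrad g ξ x r i w‖ ^ 2) ∂P := by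
        refine integral_mono_of_nonneg (Filter.Eventually.of_forall fun w => sq_nonneg _)
          (((integrable_finsetSum _ fun r _ => hint r).const_mul _).const_mul _)
          (Filter.Eventually.of_forall fun w => ?_)
        simp only [norm_smul, mul_pow, Real.norm_eq_abs, sq_abs]
        refine mul_le_mul_of_nonneg_left ?_ (sq_nonneg η)
        calc ‖∑ r ∈ Finset.Ico s t, sampledGrad g ξ x r i w‖ ^ 2
            ≤ (∑ r ∈ Finset.Ico s t, ‖sampledGrad g ξ x r i w‖) ^ 2 :=
              pow_le_pow_left₀ (norm_nonneg _) (norm_sum_le _ _) 2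
          _ ≤ _ := by
              have := sq_sum_le_card_mul_sum_sq (s := Finset.Ico s t)
                (f := fun r => ‖sampledGrad g ξ x r i w‖)
              rwa [Nat.card_Ico] at this
    _ = η ^ 2 * ((t - s : ℕ) * ∑ r ∈ Finset.Ico s t, ∫ w, ‖sampledGrad g ξ x r i w‖ ^ 2 ∂P) := by
        rw [integral_const_mul, integral_const_mul, integral_finsetSum _ fun r _ => hint r]
    _ ≤ η ^ 2 * ((t - s : ℕ) * ∑ r ∈ Finset.Ico s t, G ^ 2) := by
        gcongr with r _
        exact (h.sampledGrad_memLp r i).2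
    _ = η ^ 2 * (t - s : ℕ) ^ 2 * G ^ 2 := by simp; ring
    _ ≤ _ := by gcongr

/-- One synchronization contracts the expected potential, up to the contribution of the nodes that
stay silent. -/
lemma integral_potential_sync_le (h : IsRun P D ν f g L G σ C ω W γ η c I ξ ζ x₀ x y)
    (hn : 0 < n) (hW : W.IsHermitian) (hds : W ∈ doublyStochastic ℝ (Fin n))
    (h2 : secondAbsEigenvalue hW < 1)
    (hγ : IsConsensusStep γ (spectralGap hW) (beta hW) ω)
    {t : ℕ} (ht : t + 1 ∈ I) {τ : ℝ} (hτ : 0 ≤ τ) (hc : c t * η ^ 2 ≤ τ) :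
    ∫ w, (disagreement (fun i => x (t + 1) i w)
        + sqDist (fun i => x (t + 1) i w) (fun i => y (t + 1) i w)) ∂P
      ≤ (1 - 3 * (γ * spectralGap hW / 8)) *
          (∫ w, disagreement (fun i => x t i w - η • sampledGrad g ξ x t i w) ∂P
          + ∫ w, sqDist (fun i => x t i w - η • sampledGrad g ξ x t i w) (fun i => y t i w) ∂P)
        + 2 * ω * n * τ := by
  have hω := hγ.omega_pos
  have hω1 := hγ.omega_le_one
  have hst := fun i => h.memLp_state hω t i
  have hhalf := fun i => h.half_sub_memLp (hst i).1
  have herr := fun i => h.integral_estimate_error_le hω ht hτ hc (hst i).1 (hst i).2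
  have hAi := integrable_disagreement hhalf
  have hBi := integrable_sqDist fun i => (herr i).1
  have hUi := integrable_sqDist fun i => (hhalf i).sub (hst i).2
  have hU0 : 0 ≤ ∫ w, sqDist (fun i => x t i w - η • sampledGrad g ξ x t i w)
      (fun i => y t i w) ∂P := integral_nonneg fun w => sqDist_nonneg _ _
  have hB : ∫ w, sqDist (fun i => x t i w - η • sampledGrad g ξ x t i w)
        (fun i => y (t + 1) i w) ∂P
      ≤ (1 - ω) * ∫ w, sqDist (fun i => x t i w - η • sampledGrad g ξ x t i w)
        (fun i => y t i w) ∂P + ω * n * τ := by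
    simp only [sqDist]
    have hUi : ∀ i, Integrable
        (fun w => ‖x t i w - η • sampledGrad g ξ x t i w - y t i w‖ ^ 2) P := fun i =>
      ((hhalf i).sub (hst i).2).integrable_norm_pow two_ne_zero
    rw [integral_finsetSum _ fun i _ => (herr i).1.integrable_norm_pow two_ne_zero,
      integral_finsetSum _ fun i _ => hUi i, Finset.mul_sum]
    refine (Finset.sum_le_sum fun i _ => (herr i).2).trans_eq ?_
    rw [Finset.sum_add_distrib]
    simp; ring
  have hstep : ∫ w, (disagreement (fun i => x (t + 1) i w)
        + sqDist (fun i => x (t + 1) i w) (fun i => y (t + 1) i w)) ∂P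
      ≤ (1 - 3 / 8 * (γ * spectralGap hW)) *
          ∫ w, disagreement (fun i => x t i w - η • sampledGrad g ξ x t i w) ∂P
        + (1 + 3 / 4 * ω) * ∫ w, sqDist (fun i => x t i w - η • sampledGrad g ξ x t i w)
        (fun i => y (t + 1) i w) ∂P := by
    rw [← integral_const_mul, ← integral_const_mul,
      ← integral_add (hAi.const_mul _) (hBi.const_mul _)]
    refine integral_mono_of_nonneg (Filter.Eventually.of_forall fun w =>
      add_nonneg (disagreement_nonneg _) (sqDist_nonneg _ _))
      ((hAi.const_mul _).add (hBi.const_mul _)) (Filter.Eventually.of_forall fun w => ?_)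
    simp only [h.x_sync t ht]
    exact disagreement_add_sqDist_gossip_le hn hW hds h2 hγ _ _
  have hs : γ * spectralGap hW ≤ ω / 24 := by
    nlinarith [hγ.le, hγ.pos, hγ.gap_le_one, hγ.gap_pos]
  have hnτ : 0 ≤ ω * n * τ := by positivity
  have hB' := mul_le_mul_of_nonneg_left hB (by linarith : 0 ≤ 1 + 3 / 4 * ω)
  have hcoef : (1 + 3 / 4 * ω) * (1 - ω) ≤ 1 - 3 / 8 * (γ * spectralGap hW) := by
    nlinarith [mul_pos hω hω]
  have hB'' := mul_le_mul_of_nonneg_right hcoef hU0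
  nlinarith [mul_le_mul_of_nonneg_right hω1 hnτ]

/-- At every synchronization the expected potential is at most the fixed point of the contraction:
the drift between synchronizations enters with the factor `1 / p ^ 2`, the silent nodes with
`1 / p`. -/
lemma integral_potential_le (h : IsRun P D ν f g L G σ C ω W γ η c I ξ ζ x₀ x y)
    (hn : 0 < n) (hW : W.IsHermitian) (hds : W ∈ doublyStochastic ℝ (Fin n))
    (h2 : secondAbsEigenvalue hW < 1)
    (hγ : IsConsensusStep γ (spectralGap hW) (beta hW) ω) {T H : ℕ} (hI : IsSyncSet I T H)
    {τ p : ℝ} (hτ : 0 ≤ τ) (hc : ∀ t < T, c t * η ^ 2 ≤ τ) (hp : p = γ * spectralGap hW / 8)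
    (t : ℕ) (ht : t ∈ I) :
    ∫ w, (disagreement (fun i => x t i w) + sqDist (fun i => x t i w) (fun i => y t i w)) ∂P
      ≤ n * (4 * (η ^ 2 * H ^ 2 * G ^ 2) / p ^ 2 + 2 * ω * τ / p) := by
  have hω := hγ.omega_pos
  have hp0 : 0 < p := by rw [hp]; have := hγ.pos; have := hγ.gap_pos; positivity
  have hp1 : 3 * p ≤ 1 := by
    rw [hp]; nlinarith [hγ.le, hγ.pos, hγ.gap_le_one, hγ.gap_pos, hγ.omega_le_one]
  set Q := η ^ 2 * H ^ 2 * G ^ 2 with hQ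
  have hQ0 : 0 ≤ Q := by positivity
  induction t using Nat.strong_induction_on with
  | _ t ih =>
  rcases t.eq_zero_or_pos with rfl | ht0
  · simp only [h.x_zero, h.y_zero, disagreement, sqDist, avg_const hn]
    simp only [sub_self, norm_zero]
    norm_num
    positivity
  obtain ⟨t, rfl⟩ : ∃ t', t = t' + 1 := ⟨t - 1, by omega⟩
  have htT : t + 1 ≤ T := by simpa [Nat.lt_succ_iff] using hI.subset ht
  obtain ⟨s, hsI, hst, hH, hno⟩ := hI.exists_prev ht0 htT
  have hih := ih s hst hsI
  have hsync := h.integral_potential_sync_le hn hW hds h2 hγ ht hτ (hc t (by omega))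
  rw [← hp] at hsync
  set N : Fin n → Ω → EuclideanSpace ℝ (Fin d) := fun i w =>
    -(η • ∑ r ∈ Finset.Ico s (t + 1), sampledGrad g ξ x r i w) with hN
  have hN2 : ∀ i, MemLp (N i) 2 P ∧ ∫ w, ‖N i w‖ ^ 2 ∂P ≤ Q := fun i => by
    have := h.integral_norm_sum_sampledGrad_sq_le s (t + 1) hH i
    simp only [hN, norm_neg]
    exact ⟨this.1.neg, this.2⟩
  have hhalf : ∀ i w, x t i w - η • sampledGrad g ξ x t i w = x s i w + N i w := by
    intro i w
    rw [(h.toIsTrajectory.state_of_no_sync (Nat.lt_succ_iff.1 hst)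
      (fun r h1 h3 => hno r h1 (by omega)) i w).1, hN]
    simp only [Finset.sum_Ico_succ_top (Nat.lt_succ_iff.1 hst), smul_add]
    abel
  have hy : ∀ i w, y t i w = y s i w := fun i w =>
    (h.toIsTrajectory.state_of_no_sync (Nat.lt_succ_iff.1 hst)
      (fun r h1 h3 => hno r h1 (by omega)) i w).2
  simp only [hhalf, hy] at hsync
  have hst' := fun i => h.memLp_state hω s i
  have hAi := integrable_disagreement fun i => (hst' i).1
  have hUi := integrable_sqDist fun i => (hst' i).1.sub (hst' i).2
  have hNi : Integrable (fun w => ∑ i, ‖N i w‖ ^ 2) P :=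
    integrable_finsetSum _ fun i _ => (hN2 i).1.integrable_norm_pow two_ne_zero
  have hNs : ∫ w, ∑ i, ‖N i w‖ ^ 2 ∂P ≤ n * Q := by
    rw [integral_finsetSum _ fun i _ => (hN2 i).1.integrable_norm_pow two_ne_zero]
    refine (Finset.sum_le_sum fun i _ => (hN2 i).2).trans_eq ?_
    simp
  have hA : ∫ w, disagreement (fun i => x s i w + N i w) ∂P
      ≤ (1 + p) * ∫ w, disagreement (fun i => x s i w) ∂P
        + (1 + 1 / p) * ∫ w, ∑ i, ‖N i w‖ ^ 2 ∂P := by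
    rw [← integral_const_mul, ← integral_const_mul,
      ← integral_add (hAi.const_mul _) (hNi.const_mul _)]
    exact integral_mono_of_nonneg (Filter.Eventually.of_forall fun w => disagreement_nonneg _)
      ((hAi.const_mul _).add (hNi.const_mul _))
      (Filter.Eventually.of_forall fun w => disagreement_add_le hn hp0 _ _)
  have hU : ∫ w, sqDist (fun i => x s i w + N i w) (fun i => y s i w) ∂P
      ≤ (1 + p) * ∫ w, sqDist (fun i => x s i w) (fun i => y s i w) ∂P
        + (1 + 1 / p) * ∫ w, ∑ i, ‖N i w‖ ^ 2 ∂P := by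
    rw [← integral_const_mul, ← integral_const_mul,
      ← integral_add (hUi.const_mul _) (hNi.const_mul _)]
    exact integral_mono_of_nonneg (Filter.Eventually.of_forall fun w => sqDist_nonneg _ _)
      ((hUi.const_mul _).add (hNi.const_mul _))
      (Filter.Eventually.of_forall fun w => sqDist_add_le hp0 _ _ _)
  rw [integral_add hAi hUi] at hih
  set e := ∫ w, disagreement (fun i => x s i w) ∂P
    + ∫ w, sqDist (fun i => x s i w) (fun i => y s i w) ∂P with he
  have he0 : 0 ≤ e := add_nonneg (integral_nonneg fun w => disagreement_nonneg _)
    (integral_nonneg fun w => sqDist_nonneg _ _)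
  set B := (n : ℝ) * (4 * Q / p ^ 2 + 2 * ω * τ / p) with hB
  have hpB : p * B = 4 * (n * Q) / p + 2 * ω * n * τ := by rw [hB]; field_simp
  have h1p : 1 + 1 / p ≤ 2 / p := by
    rw [add_div' _ _ _ hp0.ne', div_le_div_iff_of_pos_right hp0]; linarith
  have hhalf_le : ∫ w, disagreement (fun i => x s i w + N i w) ∂P
      + ∫ w, sqDist (fun i => x s i w + N i w) (fun i => y s i w) ∂P
      ≤ (1 + p) * e + 4 * (n * Q) / p := by
    have h3 : (1 + 1 / p) * ∫ w, ∑ i, ‖N i w‖ ^ 2 ∂P ≤ 2 / p * (n * Q) :=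
      mul_le_mul h1p hNs (integral_nonneg fun w => Finset.sum_nonneg fun _ _ => sq_nonneg _)
        (by positivity)
    have h4 : 4 * (n * Q) / p = 2 / p * (n * Q) + 2 / p * (n * Q) := by ring
    rw [h4]; linarith
  calc _ ≤ _ := hsync
    _ ≤ (1 - 3 * p) * ((1 + p) * e + 4 * (n * Q) / p) + 2 * ω * n * τ := by
        have : 0 ≤ 1 - 3 * p := by linarith
        gcongr
    _ ≤ (1 - p) * e + 4 * (n * Q) / p + 2 * ω * n * τ := by
        have h5 : 0 ≤ 4 * (n * Q) / p := by positivity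
        nlinarith [mul_nonneg hp0.le h5, mul_nonneg hp0.le he0,
          mul_nonneg (mul_nonneg hp0.le hp0.le) he0]
    _ ≤ (1 - p) * B + p * B := by
        rw [hpB]
        have : (1 - p) * e ≤ (1 - p) * B := mul_le_mul_of_nonneg_left hih (by linarith)
        linarith
    _ = B := by ring

/-- The expected disagreement at any time: the one at the last synchronization, plus the drift since
then. -/
lemma integral_disagreement_le (h : IsRun P D ν f g L G σ C ω W γ η c I ξ ζ x₀ x y)
    (hn : 0 < n) (hW : W.IsHermitian) (hds : W ∈ doublyStochastic ℝ (Fin n))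
    (h2 : secondAbsEigenvalue hW < 1)
    (hγ : IsConsensusStep γ (spectralGap hW) (beta hW) ω) {T H : ℕ} (hI : IsSyncSet I T H)
    {τ p : ℝ} (hτ : 0 ≤ τ) (hc : ∀ t < T, c t * η ^ 2 ≤ τ) (hp : p = γ * spectralGap hW / 8)
    (t : ℕ) (ht : t < T) :
    ∫ w, disagreement (fun i => x t i w) ∂P
      ≤ n * (10 * (η ^ 2 * H ^ 2 * G ^ 2) / p ^ 2 + 4 * ω * τ / p) := by
  have hω := hγ.omega_pos
  have hp0 : 0 < p := by rw [hp]; have := hγ.pos; have := hγ.gap_pos; positivity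
  have hp1 : 3 * p ≤ 1 := by
    rw [hp]; nlinarith [hγ.le, hγ.pos, hγ.gap_le_one, hγ.gap_pos, hγ.omega_le_one]
  set Q := η ^ 2 * H ^ 2 * G ^ 2 with hQ
  have hQ0 : 0 ≤ Q := by positivity
  obtain ⟨s, hsI, hst, hH, hno⟩ := hI.exists_prev t.succ_pos ht
  have hst := Nat.lt_succ_iff.1 hst
  have hpot := h.integral_potential_le hn hW hds h2 hγ hI hτ hc hp s hsI
  set N : Fin n → Ω → EuclideanSpace ℝ (Fin d) := fun i w =>
    -(η • ∑ r ∈ Finset.Ico s t, sampledGrad g ξ x r i w) with hN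
  have hN2 : ∀ i, MemLp (N i) 2 P ∧ ∫ w, ‖N i w‖ ^ 2 ∂P ≤ Q := fun i => by
    have := h.integral_norm_sum_sampledGrad_sq_le (H := H) s t (by omega) i
    simp only [hN, norm_neg]
    exact ⟨this.1.neg, this.2⟩
  have hx : ∀ i w, x t i w = x s i w + N i w := fun i w => by
    rw [(h.toIsTrajectory.state_of_no_sync hst (fun r h1 h3 => hno r h1 (by omega)) i w).1, hN,
      sub_eq_add_neg]
  have hst' := fun i => h.memLp_state hω s i
  have hAi := integrable_disagreement fun i => (hst' i).1
  have hUi := integrable_sqDist fun i => (hst' i).1.sub (hst' i).2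
  have hNi : Integrable (fun w => ∑ i, ‖N i w‖ ^ 2) P :=
    integrable_finsetSum _ fun i _ => (hN2 i).1.integrable_norm_pow two_ne_zero
  have hNs : ∫ w, ∑ i, ‖N i w‖ ^ 2 ∂P ≤ n * Q := by
    rw [integral_finsetSum _ fun i _ => (hN2 i).1.integrable_norm_pow two_ne_zero]
    refine (Finset.sum_le_sum fun i _ => (hN2 i).2).trans_eq ?_
    simp
  have hA : ∫ w, disagreement (fun i => x s i w + N i w) ∂P
      ≤ (1 + 1) * ∫ w, disagreement (fun i => x s i w) ∂P
        + (1 + 1 / 1) * ∫ w, ∑ i, ‖N i w‖ ^ 2 ∂P := by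
    rw [← integral_const_mul, ← integral_const_mul,
      ← integral_add (hAi.const_mul _) (hNi.const_mul _)]
    exact integral_mono_of_nonneg (Filter.Eventually.of_forall fun w => disagreement_nonneg _)
      ((hAi.const_mul _).add (hNi.const_mul _))
      (Filter.Eventually.of_forall fun w => disagreement_add_le hn one_pos _ _)
  simp only [hx]
  rw [integral_add hAi hUi] at hpot
  have hU0 : 0 ≤ ∫ w, sqDist (fun i => x s i w) (fun i => y s i w) ∂P :=
    integral_nonneg fun w => sqDist_nonneg _ _
  have hQp : n * Q ≤ n * (Q / p ^ 2) := by
    gcongr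
    rw [le_div_iff₀ (by positivity)]
    exact mul_le_of_le_one_right hQ0 (pow_le_one₀ hp0.le (by linarith))
  have e1 : (n : ℝ) * (10 * Q / p ^ 2 + 4 * ω * τ / p)
      = 2 * (n * (4 * Q / p ^ 2 + 2 * ω * τ / p)) + 2 * (n * (Q / p ^ 2)) := by ring
  rw [e1]
  linarith

end IsRun

end Consensus

/-! ### Descent along the averaged iterates -/

section Descent

variable {n d : ℕ} {f : Fin n → EuclideanSpace ℝ (Fin d) → ℝ} {L : ℝ}

lemma LSmooth.hasGradientAt {F : EuclideanSpace ℝ (Fin d) → ℝ} (hF : LSmooth L F)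
    (a : EuclideanSpace ℝ (Fin d)) : HasGradientAt F (gradient F a) a :=
  (hF.1 a).hasGradientAt

lemma gradient_objective (hf : ∀ i, LSmooth L (f i)) (a : EuclideanSpace ℝ (Fin d)) :
    HasGradientAt (objective f) (avg fun i => gradient (f i) a) a := by
  rw [hasGradientAt_iff_hasFDerivAt, avg, map_smul, map_sum]
  exact (HasFDerivAt.fun_sum fun i _ =>
    hasGradientAt_iff_hasFDerivAt.1 ((hf i).hasGradientAt a)).const_mul _

lemma norm_avg_sq_le {E : Type*} [NormedAddCommGroup E] [NormedSpace ℝ E] (v : Fin n → E) :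
    ‖avg v‖ ^ 2 ≤ 1 / n * ∑ i, ‖v i‖ ^ 2 := by
  rcases n.eq_zero_or_pos with rfl | hn
  · simp [avg]
  have h0 : (0 : ℝ) < n := by exact_mod_cast hn
  have h1 : ‖∑ i, v i‖ ^ 2 ≤ n * ∑ i, ‖v i‖ ^ 2 := by
    refine (pow_le_pow_left₀ (norm_nonneg _) (norm_sum_le _ _) 2).trans ?_
    have := sq_sum_le_card_mul_sum_sq (s := Finset.univ) (f := fun i => ‖v i‖)
    rwa [Finset.card_univ, Fintype.card_fin] at this
  rw [avg, norm_smul, mul_pow, Real.norm_eq_abs, sq_abs]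
  calc (1 / (n : ℝ)) ^ 2 * ‖∑ i, v i‖ ^ 2 ≤ (1 / (n : ℝ)) ^ 2 * (n * ∑ i, ‖v i‖ ^ 2) := by gcongr
    _ = _ := by field_simp

lemma lsmooth_objective (hn : 0 < n) (hf : ∀ i, LSmooth L (f i)) : LSmooth L (objective f) := by
  refine ⟨fun a => (gradient_objective hf a).differentiableAt, fun a b => ?_⟩
  rw [(gradient_objective hf a).gradient, (gradient_objective hf b).gradient, ← avg_sub]
  have h0 : (0 : ℝ) < n := by exact_mod_cast hn
  rw [avg, norm_smul, Real.norm_of_nonneg (by positivity)]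
  calc 1 / (n : ℝ) * ‖∑ i, (gradient (f i) a - gradient (f i) b)‖
      ≤ 1 / (n : ℝ) * ∑ _i : Fin n, L * ‖a - b‖ := by
        gcongr
        exact (norm_sum_le _ _).trans (Finset.sum_le_sum fun i _ => (hf i).2 a b)
    _ = L * ‖a - b‖ := by simp; field_simp

/-- The quadratic upper bound for functions with Lipschitz gradient. -/
lemma LSmooth.le_quadratic {F : EuclideanSpace ℝ (Fin d) → ℝ} (hF : LSmooth L F)
    (a v : EuclideanSpace ℝ (Fin d)) :
    F (a + v) ≤ F a + inner ℝ (gradient F a) v + L / 2 * ‖v‖ ^ 2 := by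
  set φ : ℝ → ℝ := fun t => F (a + t • v) - t * inner ℝ (gradient F a) v - L / 2 * t ^ 2 * ‖v‖ ^ 2
    with hφ
  have hd : ∀ t, HasDerivAt φ (inner ℝ (gradient F (a + t • v)) v - inner ℝ (gradient F a) v
      - L * t * ‖v‖ ^ 2) t := by
    intro t
    have h1 : HasDerivAt (fun t : ℝ => a + t • v) v t := by
      simpa using ((hasDerivAt_id t).smul_const v).const_add a
    have h2 := (hasGradientAt_iff_hasFDerivAt.1 (hF.hasGradientAt (a + t • v))).comp_hasDerivAt t h1
    rw [InnerProductSpace.toDual_apply_apply] at h2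
    have h3 : HasDerivAt (fun t : ℝ => t * inner ℝ (gradient F a) v) (inner ℝ (gradient F a) v) t := by
      simpa using (hasDerivAt_id t).mul_const (inner ℝ (gradient F a) v)
    have h4 : HasDerivAt (fun t : ℝ => L / 2 * t ^ 2 * ‖v‖ ^ 2) (L * t * ‖v‖ ^ 2) t := by
      refine (((hasDerivAt_pow 2 t).const_mul (L / 2)).mul_const (‖v‖ ^ 2)).congr_deriv ?_
      push_cast; ring
    exact (h2.sub h3).sub h4
  have hanti : AntitoneOn φ (Set.Icc 0 1) := by
    refine antitoneOn_of_deriv_nonpos (convex_Icc 0 1)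
      (fun t _ => (hd t).continuousAt.continuousWithinAt)
      (fun t _ => (hd t).differentiableAt.differentiableWithinAt) fun t ht => ?_
    rw [interior_Icc] at ht
    rw [(hd t).deriv, ← inner_sub_left]
    have h1 := (real_inner_le_norm (gradient F (a + t • v) - gradient F a) v)
    have h2 := hF.2 (a + t • v) a
    rw [add_sub_cancel_left, norm_smul, Real.norm_of_nonneg ht.1.le] at h2
    nlinarith [mul_le_mul_of_nonneg_right h2 (norm_nonneg v)]
  have h := hanti (Set.left_mem_Icc.2 zero_le_one) (Set.right_mem_Icc.2 zero_le_one) zero_le_one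
  simp only [hφ] at h
  simp only [one_smul, zero_smul, add_zero] at h
  linarith

lemma LSmooth.abs_le (hL : 0 ≤ L) {F : EuclideanSpace ℝ (Fin d) → ℝ} (hF : LSmooth L F)
    {m : ℝ} (hm : ∀ a, m ≤ F a) (a : EuclideanSpace ℝ (Fin d)) :
    |F a| ≤ |m| + |F 0| + ‖gradient F 0‖ ^ 2 + (L + 1) * ‖a‖ ^ 2 := by
  have h := hF.le_quadratic 0 a
  rw [zero_add] at h
  have h1 := real_inner_le_norm (gradient F 0) a
  have h3 := le_abs_self (F 0)
  have h4 := neg_abs_le m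
  have h5 : 0 ≤ L * ‖a‖ ^ 2 := by positivity
  have h6 := hm a
  have h7 := abs_nonneg m
  have h8 := abs_nonneg (F 0)
  rw [_root_.abs_le]
  constructor <;> nlinarith [sq_nonneg (‖gradient F 0‖ - ‖a‖), sq_nonneg ‖a‖,
    sq_nonneg ‖gradient F 0‖]

/-- One inexact gradient step `v = -η (m + e)` with mean direction `m` and noise `e`. The terms
linear in `e` vanish in expectation. -/
lemma LSmooth.step_le {F : EuclideanSpace ℝ (Fin d) → ℝ} (hF : LSmooth L F) {η : ℝ} (hη : 0 ≤ η)
    (hηL : L * η ≤ 1) (a m e : EuclideanSpace ℝ (Fin d)) :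
    F (a - η • (m + e)) ≤ F a - η / 2 * ‖gradient F a‖ ^ 2 + η / 2 * ‖gradient F a - m‖ ^ 2
      - η * inner ℝ (gradient F a - (L * η) • m) e + L * η ^ 2 / 2 * ‖e‖ ^ 2 := by
  have h := hF.le_quadratic a (-(η • (m + e)))
  rw [← sub_eq_add_neg, inner_neg_right, norm_neg, norm_smul, mul_pow, Real.norm_eq_abs, sq_abs,
    inner_smul_right, inner_add_right, norm_add_sq_real] at h
  rw [norm_sub_sq_real (gradient F a) m, inner_sub_left, inner_smul_left]
  simp only [conj_trivial]
  have h2 : η * (L * η) * ‖m‖ ^ 2 ≤ η * 1 * ‖m‖ ^ 2 := by gcongr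
  linarith

end Descent

section Expectation

variable {n d : ℕ} {Ξ : Fin n → Type*} {Z : Type*}
  {g : (i : Fin n) → EuclideanSpace ℝ (Fin d) → Ξ i → EuclideanSpace ℝ (Fin d)}
  {C : EuclideanSpace ℝ (Fin d) → Z → EuclideanSpace ℝ (Fin d)}
  {W : Matrix (Fin n) (Fin n) ℝ} {γ η : ℝ} {c : ℕ → ℝ} {I : Finset ℕ}
  {Ω : Type*} {ξ : (i : Fin n) → ℕ → Ω → Ξ i} {ζ : Fin n → ℕ → Ω → Z}
  {x₀ : EuclideanSpace ℝ (Fin d)} {x y : ℕ → Fin n → Ω → EuclideanSpace ℝ (Fin d)}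

/-- Gossip does not move the average, so it performs a plain stochastic gradient step. -/
lemma IsTrajectory.avg_succ (h : IsTrajectory g C W γ η c I ξ ζ x₀ x y)
    (hds : W ∈ doublyStochastic ℝ (Fin n)) (t : ℕ) (w : Ω) :
    (avg fun i => x (t + 1) i w)
      = (avg fun i => x t i w) - η • avg fun i => sampledGrad g ξ x t i w := by
  rw [← avg_smul, ← avg_sub]
  by_cases ht : t + 1 ∈ I
  · simp only [h.x_sync t ht]
    exact avg_add_smul_gossip hds γ _ _
  · simp only [h.x_local t ht]

/-- The deviation of the stochastic gradient of node `i` from its mean. -/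
noncomputable def noise (f : Fin n → EuclideanSpace ℝ (Fin d) → ℝ)
    (g : (i : Fin n) → EuclideanSpace ℝ (Fin d) → Ξ i → EuclideanSpace ℝ (Fin d))
    (ξ : (i : Fin n) → ℕ → Ω → Ξ i) (x : ℕ → Fin n → Ω → EuclideanSpace ℝ (Fin d))
    (t : ℕ) (i : Fin n) (w : Ω) : EuclideanSpace ℝ (Fin d) :=
  g i (x t i w) (ξ i t w) - gradient (f i) (x t i w)

variable [∀ i, MeasurableSpace (Ξ i)] [MeasurableSpace Z]
  {f : Fin n → EuclideanSpace ℝ (Fin d) → ℝ} {L : ℝ}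

lemma measurable_noise {_m : MeasurableSpace Ω} (hf : ∀ i, LSmooth L (f i))
    (hg : ∀ i, Measurable (Function.uncurry (g i))) {t : ℕ} {i : Fin n}
    (hx : Measurable (x t i)) (hξ : Measurable (ξ i t)) : Measurable (noise f g ξ x t i) :=
  ((hg i).comp (hx.prodMk hξ)).sub ((hf i).lipschitzWith.continuous.measurable.comp hx)

lemma measurable_avg {_m : MeasurableSpace Ω} {u : Fin n → Ω → EuclideanSpace ℝ (Fin d)}
    (hu : ∀ i, Measurable (u i)) : Measurable fun w => avg fun i => u i w :=
  Measurable.const_smul (g := fun w => ∑ i, u i w) (Finset.measurable_sum _ fun i _ => hu i)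
    (1 / (n : ℝ))

lemma measurable_descentDirection {_m : MeasurableSpace Ω} (hF : LSmooth L (objective f))
    (hf : ∀ i, LSmooth L (f i)) {u : Fin n → Ω → EuclideanSpace ℝ (Fin d)}
    (hu : ∀ i, Measurable (u i)) {a : ℝ} :
    Measurable fun w => gradient (objective f) (avg fun i => u i w)
      - a • avg fun i => gradient (f i) (u i w) :=
  (hF.lipschitzWith.continuous.measurable.comp (measurable_avg hu)).sub
    ((measurable_avg fun i =>
      (hf i).lipschitzWith.continuous.measurable.comp (hu i)).const_smul a)

variable [MeasurableSpace Ω] {P : Measure Ω} {D : (i : Fin n) → Measure (Ξ i)} {ν : Measure Z}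
  {G : ℝ} {σ : Fin n → ℝ} {ω : ℝ}

lemma LSmooth.gradient_memLp [IsFiniteMeasure P] {F : EuclideanSpace ℝ (Fin d) → ℝ}
    (hF : LSmooth L F) {U : Ω → EuclideanSpace ℝ (Fin d)} (hU : MemLp U 2 P) :
    MemLp (fun w => gradient F (U w)) 2 P := by
  have h := ((hU.norm.const_mul |L|).add (memLp_const ‖gradient F 0‖))
  refine h.mono (hF.lipschitzWith.continuous.comp_aestronglyMeasurable hU.1)
    (Filter.Eventually.of_forall fun w => ?_)
  have h1 := hF.2 (U w) 0
  rw [sub_zero] at h1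
  have h2 := norm_le_norm_add_norm_sub' (gradient F (U w)) (gradient F 0)
  have h3 : L * ‖U w‖ ≤ |L| * ‖U w‖ := by gcongr; exact le_abs_self L
  simp only [Pi.add_apply]
  rw [Real.norm_of_nonneg (by positivity)]
  linarith

lemma LSmooth.integrable_comp [IsFiniteMeasure P] (hL : 0 ≤ L)
    {F : EuclideanSpace ℝ (Fin d) → ℝ} (hF : LSmooth L F) (hb : BddBelow (Set.range F))
    {U : Ω → EuclideanSpace ℝ (Fin d)} (hU : MemLp U 2 P) : Integrable (fun w => F (U w)) P := by
  obtain ⟨m, hm⟩ := hb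
  have h := ((integrable_const (|m| + |F 0| + ‖gradient F 0‖ ^ 2)).add
    ((hU.integrable_norm_pow two_ne_zero).const_mul (L + 1)) : Integrable _ P)
  exact h.mono' (hF.1.continuous.comp_aestronglyMeasurable hU.1)
    (Filter.Eventually.of_forall fun w => hF.abs_le hL (fun a => hm ⟨a, rfl⟩) (U w))

namespace IsRun

variable [IsProbabilityMeasure P]

lemma noise_memLp (h : IsRun P D ν f g L G σ C ω W γ η c I ξ ζ x₀ x y) (t : ℕ) (i : Fin n) :
    MemLp (noise f g ξ x t i) 2 P ∧ ∫ w, ‖noise f g ξ x t i w‖ ^ 2 ∂P ≤ σ i ^ 2 :=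
  (h.stochasticGradient i).integral_noise_sq_le (h.smooth i) (h.measurable_x t i)
    (h.sampling.measurable_sample i t)
    (h.indepFun_sample (h.measurable_state_others_sample i i t)) (h.sampling.law_sample i t)

lemma integral_inner_noise (h : IsRun P D ν f g L G σ C ω W γ η c I ξ ζ x₀ x y) (t : ℕ)
    (i : Fin n) {V : Ω → EuclideanSpace ℝ (Fin d)} (hV : MemLp V 2 P) (hVm : Measurable V)
    (hVo : Measurable[others ξ ζ (Sum.inl (i, t))] V) :
    ∫ w, inner ℝ (V w) (noise f g ξ x t i w) ∂P = 0 :=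
  (h.stochasticGradient i).integral_inner_noise (h.smooth i) (h.measurable_x t i) hVm hV
    (h.sampling.measurable_sample i t)
    (h.indepFun_sample (hVo.prodMk (h.measurable_state_others_sample i i t)))
    (h.sampling.law_sample i t)

/-- Averaging over `n` independent nodes reduces the variance by the factor `n`: the noises of
different nodes are orthogonal. -/
lemma integral_norm_avg_noise_sq_le (h : IsRun P D ν f g L G σ C ω W γ η c I ξ ζ x₀ x y) (t : ℕ) :
    ∫ w, ‖avg fun i => noise f g ξ x t i w‖ ^ 2 ∂P ≤ 1 / n * (1 / n * ∑ i, σ i ^ 2) := by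
  have hN := h.noise_memLp t
  have hij : ∀ i j, Integrable
      (fun w => (inner ℝ (noise f g ξ x t i w) (noise f g ξ x t j w) : ℝ)) P :=
    fun i j => integrable_inner_of_memLp (hN i).1 (hN j).1
  have horth : ∀ i j, i ≠ j →
      ∫ w, inner ℝ (noise f g ξ x t i w) (noise f g ξ x t j w) ∂P = 0 := by
    intro i j hne
    refine h.integral_inner_noise t j (hN i).1 ?_ ?_
    · exact measurable_noise h.smooth (fun i => (h.stochasticGradient i).measurable)
        (h.measurable_x t i) (h.sampling.measurable_sample i t)
    · exact measurable_noise (_m := others ξ ζ (Sum.inl (j, t))) h.smooth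
        (fun i => (h.stochasticGradient i).measurable)
        (h.measurable_state_others_sample j i t) (measurable_sample_others (by simp [hne]))
  have e : ∀ w, ‖avg fun i => noise f g ξ x t i w‖ ^ 2
      = (1 / (n : ℝ)) ^ 2 * ∑ i, ∑ j, inner ℝ (noise f g ξ x t i w) (noise f g ξ x t j w) := by
    intro w
    rw [avg, norm_smul, mul_pow, Real.norm_eq_abs, sq_abs, ← real_inner_self_eq_norm_sq]
    simp only [sum_inner, inner_sum]
    rw [Finset.sum_comm]
  simp only [e]
  rw [integral_const_mul, integral_finsetSum _ fun i _ => integrable_finsetSum _ fun j _ => hij i j]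
  have hle : ∑ i, ∫ w, ∑ j, inner ℝ (noise f g ξ x t i w) (noise f g ξ x t j w) ∂P
      ≤ ∑ i, σ i ^ 2 := by
    refine Finset.sum_le_sum fun i _ => ?_
    rw [integral_finsetSum _ fun j _ => hij i j,
      Finset.sum_eq_single i (fun j _ hj => horth i j hj.symm) (by simp)]
    simp only [real_inner_self_eq_norm_sq]
    exact (hN i).2
  calc _ ≤ (1 / (n : ℝ)) ^ 2 * ∑ i, σ i ^ 2 := by gcongr
    _ = _ := by ring

/-- The expected decrease of the objective in one step. -/
lemma integral_objective_succ_le (h : IsRun P D ν f g L G σ C ω W γ η c I ξ ζ x₀ x y)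
    (hn : 0 < n) (hω : 0 < ω) (hL : 0 ≤ L) (hb : BddBelow (Set.range (objective f)))
    (hds : W ∈ doublyStochastic ℝ (Fin n)) (hη : 0 ≤ η) (hηL : L * η ≤ 1) (t : ℕ) :
    ∫ w, objective f (avg fun i => x (t + 1) i w) ∂P ≤
      ∫ w, objective f (avg fun i => x t i w) ∂P
      - η / 2 * ∫ w, ‖gradient (objective f) (avg fun i => x t i w)‖ ^ 2 ∂P
      + η / 2 * (L ^ 2 / n * ∫ w, disagreement (fun i => x t i w) ∂P)
      + L * η ^ 2 / 2 * (1 / n * (1 / n * ∑ i, σ i ^ 2)) := by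
  have hF := lsmooth_objective hn h.smooth
  have hx := fun i => (h.memLp_state hω t i).1
  have hx' := fun i => (h.memLp_state hω (t + 1) i).1
  set xb : Ω → EuclideanSpace ℝ (Fin d) := fun w => avg fun i => x t i w with hxb
  set m : Ω → EuclideanSpace ℝ (Fin d) := fun w => avg fun i => gradient (f i) (x t i w) with hm
  set e : Ω → EuclideanSpace ℝ (Fin d) := fun w => avg fun i => noise f g ξ x t i w with he
  have hxb2 : MemLp xb 2 P := memLp_avg hx
  have hgx2 := hF.gradient_memLp hxb2
  have hm2 : MemLp m 2 P := memLp_avg fun i => (h.smooth i).gradient_memLp (hx i)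
  have he2 : MemLp e 2 P := memLp_avg fun i => (h.noise_memLp t i).1
  set V : Ω → EuclideanSpace ℝ (Fin d) := fun w =>
    gradient (objective f) (xb w) - (L * η) • m w with hV
  have hV2 : MemLp V 2 P := hgx2.sub (hm2.const_smul (L * η))
  -- `V` is a function of the state at time `t`, hence orthogonal to the noise at time `t`
  have hsm := h.smooth
  have hVmeas : ∀ m' : MeasurableSpace Ω, (∀ i, Measurable[m'] (x t i)) → Measurable[m'] V :=
    fun m' hxm => measurable_descentDirection hF hsm hxm
  have hVe : ∫ w, inner ℝ (V w) (e w) ∂P = 0 := by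
    have e1 : ∀ w, (inner ℝ (V w) (e w) : ℝ)
        = 1 / n * ∑ i, inner ℝ (V w) (noise f g ξ x t i w) := fun w => by
      simp only [he, avg, inner_smul_right, inner_sum]
    simp only [e1]
    rw [integral_const_mul, integral_finsetSum _ fun i _ =>
      integrable_inner_of_memLp hV2 (h.noise_memLp t i).1]
    rw [Finset.sum_eq_zero fun i _ => h.integral_inner_noise t i hV2
      (hVmeas _ fun j => h.measurable_x t j)
      (hVmeas _ fun j => h.measurable_state_others_sample i j t), mul_zero]
  have hstep : ∀ w, objective f (avg fun i => x (t + 1) i w)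
      ≤ objective f (xb w) - η / 2 * ‖gradient (objective f) (xb w)‖ ^ 2
        + η / 2 * (L ^ 2 / n * disagreement fun i => x t i w)
        - η * inner ℝ (V w) (e w) + L * η ^ 2 / 2 * ‖e w‖ ^ 2 := by
    intro w
    have e1 : (avg fun i => x (t + 1) i w) = xb w - η • (m w + e w) := by
      rw [h.toIsTrajectory.avg_succ hds, hm, he]
      simp only [← avg_add, noise, add_sub_cancel, sampledGrad, hxb]
    have h1 := hF.step_le hη hηL (xb w) (m w) (e w)
    rw [← e1] at h1
    have h2 : ‖gradient (objective f) (xb w) - m w‖ ^ 2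
        ≤ L ^ 2 / n * disagreement fun i => x t i w := by
      rw [(gradient_objective h.smooth (xb w)).gradient, hm, ← avg_sub]
      refine (norm_avg_sq_le _).trans ?_
      rw [disagreement, div_eq_mul_one_div (L ^ 2), mul_comm (L ^ 2), mul_assoc]
      refine mul_le_mul_of_nonneg_left ?_ (by positivity)
      rw [Finset.mul_sum]
      refine Finset.sum_le_sum fun i _ => ?_
      rw [← mul_pow, norm_sub_rev (x t i w)]
      exact pow_le_pow_left₀ (norm_nonneg _) ((h.smooth i).2 _ _) 2
    have h3 := mul_le_mul_of_nonneg_left h2 (by positivity : 0 ≤ η / 2)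
    linarith
  have i0 := hF.integrable_comp hL hb (memLp_avg hx')
  have i1 := hF.integrable_comp hL hb hxb2
  have i2 := (hgx2.integrable_norm_pow two_ne_zero).const_mul (η / 2)
  have i3 := ((integrable_disagreement hx).const_mul (L ^ 2 / n)).const_mul (η / 2)
  have i4 := (integrable_inner_of_memLp hV2 he2).const_mul η
  have i5 := (he2.integrable_norm_pow two_ne_zero).const_mul (L * η ^ 2 / 2)
  have i12 : Integrable (fun w => objective f (xb w)
      - η / 2 * ‖gradient (objective f) (xb w)‖ ^ 2) P := i1.sub i2
  have i13 : Integrable (fun w => objective f (xb w)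
      - η / 2 * ‖gradient (objective f) (xb w)‖ ^ 2
      + η / 2 * (L ^ 2 / n * disagreement fun i => x t i w)) P := i12.add i3
  have i14 : Integrable (fun w => objective f (xb w)
      - η / 2 * ‖gradient (objective f) (xb w)‖ ^ 2
      + η / 2 * (L ^ 2 / n * disagreement fun i => x t i w)
      - η * inner ℝ (V w) (e w)) P := i13.sub i4
  have hint := integral_mono i0 (i14.add i5) hstep
  rw [integral_add' i14 i5, integral_sub i13 i4, integral_add i12 i3, integral_sub i1 i2] at hint
  simp only [integral_const_mul] at hint
  rw [hVe] at hint
  have hne := mul_le_mul_of_nonneg_left (h.integral_norm_avg_noise_sq_le t)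
    (by positivity : 0 ≤ L * η ^ 2 / 2)
  linarith

end IsRun

end Expectation

/-! ### The convergence rate -/

section Rate

variable {n d : ℕ} {Ξ : Fin n → Type*} {Z : Type*}
  {g : (i : Fin n) → EuclideanSpace ℝ (Fin d) → Ξ i → EuclideanSpace ℝ (Fin d)}
  {C : EuclideanSpace ℝ (Fin d) → Z → EuclideanSpace ℝ (Fin d)}
  {W : Matrix (Fin n) (Fin n) ℝ} {γ η : ℝ} {c : ℕ → ℝ} {I : Finset ℕ}
  {Ω : Type*} {ξ : (i : Fin n) → ℕ → Ω → Ξ i} {ζ : Fin n → ℕ → Ω → Z}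
  {x₀ : EuclideanSpace ℝ (Fin d)} {x y : ℕ → Fin n → Ω → EuclideanSpace ℝ (Fin d)}
  [∀ i, MeasurableSpace (Ξ i)] [MeasurableSpace Z]
  [MeasurableSpace Ω] {P : Measure Ω} {D : (i : Fin n) → Measure (Ξ i)} {ν : Measure Z}
  {f : Fin n → EuclideanSpace ℝ (Fin d) → ℝ} {L G : ℝ} {σ : Fin n → ℝ} {ω : ℝ}
  [IsProbabilityMeasure P]

/-- The expected decreases telescope; a bound `n * B` on the disagreement enters with the factor
`L ^ 2`. -/
lemma IsRun.average_gradient_le (h : IsRun P D ν f g L G σ C ω W γ η c I ξ ζ x₀ x y)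
    (hn : 0 < n) (hω : 0 < ω) (hL : 0 ≤ L) (hb : BddBelow (Set.range (objective f)))
    (hds : W ∈ doublyStochastic ℝ (Fin n)) (hη : 0 < η) (hηL : L * η ≤ 1) {T : ℕ} (hT : 0 < T)
    {B : ℝ} (hB : ∀ t < T, ∫ w, disagreement (fun i => x t i w) ∂P ≤ n * B) :
    1 / (T : ℝ) * ∑ t ∈ Finset.range T,
        ∫ w, ‖gradient (objective f) (avg fun i => x t i w)‖ ^ 2 ∂P
      ≤ 2 * (objective f x₀ - ⨅ a, objective f a) / (η * T) + L ^ 2 * B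
        + L * (1 / (n : ℝ) * ∑ i, σ i ^ 2) * (η / n) := by
  have hn0 : (0 : ℝ) < n := by exact_mod_cast hn
  have hT0 : (0 : ℝ) < T := by exact_mod_cast hT
  set S := 1 / (n : ℝ) * ∑ i, σ i ^ 2 with hS
  set a : ℕ → ℝ := fun t => ∫ w, objective f (avg fun i => x t i w) ∂P with ha
  set N : ℕ → ℝ := fun t => ∫ w, ‖gradient (objective f) (avg fun i => x t i w)‖ ^ 2 ∂P with hN
  have hstep : ∀ t ∈ Finset.range T,
      η / 2 * N t ≤ a t - a (t + 1) + (η / 2 * (L ^ 2 * B) + L * η ^ 2 / 2 * (1 / n * S)) := by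
    intro t ht
    have h1 := h.integral_objective_succ_le hn hω hL hb hds hη.le hηL t
    have h2 : L ^ 2 / n * ∫ w, disagreement (fun i => x t i w) ∂P ≤ L ^ 2 * B := by
      calc _ ≤ L ^ 2 / n * (n * B) := by gcongr; exact hB t (Finset.mem_range.1 ht)
        _ = _ := by field_simp
    have h3 := mul_le_mul_of_nonneg_left h2 (by positivity : 0 ≤ η / 2)
    simp only [ha, hN]
    linarith
  have hsum := Finset.sum_le_sum hstep
  rw [← Finset.mul_sum, Finset.sum_add_distrib, Finset.sum_range_sub', Finset.sum_const,
    Finset.card_range, nsmul_eq_mul] at hsum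
  have ha0 : a 0 = objective f x₀ := by
    simp [ha, h.x_zero, avg_const hn]
  have haT : ⨅ b, objective f b ≤ a T := by
    have hi := (lsmooth_objective hn h.smooth).integrable_comp hL hb
      (memLp_avg fun i => (h.memLp_state hω T i).1)
    calc ⨅ b, objective f b = ∫ _, ⨅ b, objective f b ∂P := by simp
      _ ≤ _ := integral_mono (integrable_const _) hi fun w => ciInf_le hb _
  have hN' : ∑ t ∈ Finset.range T, N t
      ≤ 2 / η * (objective f x₀ - (⨅ b, objective f b)
        + T * (η / 2 * (L ^ 2 * B) + L * η ^ 2 / 2 * (1 / n * S))) := by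
    have h4 : ∑ t ∈ Finset.range T, N t = 2 / η * (η / 2 * ∑ t ∈ Finset.range T, N t) := by
      field_simp
    rw [h4]
    gcongr
    linarith
  calc 1 / (T : ℝ) * ∑ t ∈ Finset.range T, N t
      ≤ 1 / (T : ℝ) * (2 / η * (objective f x₀ - (⨅ b, objective f b)
        + T * (η / 2 * (L ^ 2 * B) + L * η ^ 2 / 2 * (1 / n * S)))) := by gcongr
    _ = _ := by field_simp; ring

/-- The convergence rate, with the constant `10`, for an abstract run of SPARQ-SGD. -/
lemma IsRun.rate (hrun : IsRun P D ν f g L G σ C ω W γ η c I ξ ζ x₀ x y) {T H : ℕ}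
    (hn : 0 < n) (hT : 0 < T) (hL : 0 ≤ L) (hb : BddBelow (Set.range (objective f)))
    (hω : 0 < ω) (hω1 : ω ≤ 1) (hW : W.IsHermitian)
    (hds : W ∈ doublyStochastic ℝ (Fin n)) (h2 : secondAbsEigenvalue hW < 1)
    (hI : IsSyncSet I T H) {p ε : ℝ} (hη : η = √((n : ℝ) / T))
    (hγ : γ = consensusStep (spectralGap hW) (beta hW) ω)
    (hp : p = γ * spectralGap hW / 8) (hTL : 64 * (n : ℝ) * L ^ 2 ≤ T)
    (hc : ∀ t < T, c t ≤ 1 / η ^ (1 - ε)) :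
    1 / (T : ℝ) * ∑ t ∈ Finset.range T,
        ∫ w, ‖gradient (objective f) (avg fun i => x t i w)‖ ^ 2 ∂P ≤
      4 * (objective f x₀ - (⨅ x, objective f x) + L * ((1 / (n : ℝ)) * ∑ i, σ i ^ 2))
          / √((n : ℝ) * T)
        + 10 * (G ^ 2 * (H : ℝ) ^ 2 * L ^ 2 * n / (p ^ 2 * T))
        + 10 * (L ^ 2 * ω * ((n : ℝ) / T) ^ ((1 + ε) / 2) / p) := by
  have hn0 : (0 : ℝ) < n := by exact_mod_cast hn
  have hT0 : (0 : ℝ) < T := by exact_mod_cast hT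
  have hq : (0 : ℝ) < n / T := by positivity
  have hη0 : 0 < η := by rw [hη]; exact Real.sqrt_pos.2 hq
  have hη2 : η ^ 2 = n / T := by rw [hη, Real.sq_sqrt hq.le]
  have hηL : L * η ≤ 1 := by
    have h1 : (L * η) ^ 2 ≤ 1 := by
      rw [mul_pow, hη2, ← mul_div_assoc, div_le_one hT0]
      have : 0 ≤ (n : ℝ) * L ^ 2 := by positivity
      linarith
    exact (abs_le_one_iff_mul_self_le_one.2 (by rwa [← sq])).trans' (le_abs_self _)
  have hδ : 0 < spectralGap hW := sub_pos.2 h2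
  have hδ1 : spectralGap hW ≤ 1 := by
    rw [spectralGap]; linarith [secondAbsEigenvalue_nonneg hW]
  have hstep : IsConsensusStep γ (spectralGap hW) (beta hW) ω := hγ ▸
    isConsensusStep_consensusStep hδ hδ1 (beta_nonneg hn hW hds h2)
      (beta_eq_zero_or_spectralGap_le hn hW hds h2) hω hω1
  have hp0 : 0 < p := by rw [hp]; have := hstep.pos; positivity
  -- the thresholds `c t * η ^ 2` are at most `η ^ (1 + ε)`
  set τ := ((n : ℝ) / T) ^ ((1 + ε) / 2) with hτ
  have hτ0 : 0 ≤ τ := by positivity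
  have hτη : 1 / η ^ (1 - ε) * η ^ 2 = τ := by
    have h1 : η = ((n : ℝ) / T) ^ (1 / 2 : ℝ) := by rw [hη, Real.sqrt_eq_rpow]
    rw [hη2, h1, ← Real.rpow_mul hq.le, hτ, one_div, ← Real.rpow_neg hq.le]
    nth_rewrite 2 [← Real.rpow_one ((n : ℝ) / T)]
    rw [← Real.rpow_add hq]
    congr 1; ring
  have hcτ : ∀ t < T, c t * η ^ 2 ≤ τ := fun t ht => by
    rw [← hτη]
    exact mul_le_mul_of_nonneg_right (hc t ht) (sq_nonneg η)
  have hmain := hrun.average_gradient_le hn hω hL hb hds hη0 hηL hT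
    (hrun.integral_disagreement_le hn hW hds h2 hstep hI hτ0 hcτ hp)
  have hsqrt : √((n : ℝ) * T) = η * T := by
    rw [hη, Real.sqrt_eq_iff_mul_self_eq (by positivity) (by positivity)]
    have := Real.mul_self_sqrt hq.le
    symm
    calc √((n : ℝ) / T) * T * (√((n : ℝ) / T) * T)
        = √((n : ℝ) / T) * √((n : ℝ) / T) * T * T := by ring
      _ = n * T := by rw [this]; field_simp
  have hηn : η / n = 1 / (η * T) := by
    rw [div_eq_div_iff hn0.ne' (by positivity)]
    calc η * (η * T) = η ^ 2 * T := by ring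
      _ = 1 * n := by rw [hη2]; field_simp
  rw [hηn, hη2] at hmain
  rw [hsqrt]
  have hF : 0 ≤ (objective f x₀ - ⨅ a, objective f a) / (η * T) :=
    div_nonneg (sub_nonneg.2 (ciInf_le hb x₀)) (by positivity)
  have hS : 0 ≤ L * (1 / (n : ℝ) * ∑ i, σ i ^ 2) / (η * T) := by positivity
  have h5 : 0 ≤ L ^ 2 * ω * τ / p := by positivity
  have e1 : 2 * (objective f x₀ - ⨅ a, objective f a) / (η * T)
        + L ^ 2 * (10 * (n / T * H ^ 2 * G ^ 2) / p ^ 2 + 4 * ω * τ / p)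
        + L * (1 / (n : ℝ) * ∑ i, σ i ^ 2) * (1 / (η * T))
      = 2 * ((objective f x₀ - ⨅ a, objective f a) / (η * T))
        + L * (1 / (n : ℝ) * ∑ i, σ i ^ 2) / (η * T)
        + 10 * (G ^ 2 * (H : ℝ) ^ 2 * L ^ 2 * n / (p ^ 2 * T))
        + 4 * (L ^ 2 * ω * τ / p) := by
    field_simp
    ring
  have e2 : 4 * (objective f x₀ - (⨅ x, objective f x)
        + L * ((1 / (n : ℝ)) * ∑ i, σ i ^ 2)) / (η * T)
      = 4 * ((objective f x₀ - ⨅ a, objective f a) / (η * T))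
        + 4 * (L * (1 / (n : ℝ) * ∑ i, σ i ^ 2) / (η * T)) := by ring
  rw [e1] at hmain
  rw [e2]
  linarith

end Rate

end SparqSGD

open SparqSGD in
theorem mainTheorem2 :
    ∃ K : ℝ, 0 < K ∧
      ∀ (n d T H : ℕ) (_ : 0 < n) (_ : 0 < T)
        -- objectives and stochastic gradients
        (Ξ : Fin n → Type*) [∀ i, MeasurableSpace (Ξ i)]
        (D : (i : Fin n) → Measure (Ξ i)) [∀ i, IsProbabilityMeasure (D i)]
        (f : Fin n → EuclideanSpace ℝ (Fin d) → ℝ)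
        (g : (i : Fin n) → EuclideanSpace ℝ (Fin d) → Ξ i → EuclideanSpace ℝ (Fin d))
        (L G : ℝ) (σ : Fin n → ℝ) (_ : 0 ≤ L)
        (_ : ∀ i, SparqSGD.LSmooth L (f i))
        (_ : BddBelow (Set.range (SparqSGD.objective f)))
        (_ : ∀ i, SparqSGD.IsStochasticGradient (D i) (f i) (g i) G (σ i))
        -- compression operator
        (Z : Type*) [MeasurableSpace Z] (ν : Measure Z) [IsProbabilityMeasure ν]
        (C : EuclideanSpace ℝ (Fin d) → Z → EuclideanSpace ℝ (Fin d))
        (ω : ℝ) (_ : 0 < ω) (_ : ω ≤ 1) (_ : SparqSGD.IsCompression ν C ω)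
        -- mixing matrix
        (W : Matrix (Fin n) (Fin n) ℝ) (hW : W.IsHermitian)
        (_ : W ∈ doublyStochastic ℝ (Fin n))
        (_ : SparqSGD.secondAbsEigenvalue hW < 1)
        -- synchronization indices
        (I : Finset ℕ) (_ : SparqSGD.IsSyncSet I T H)
        -- step sizes, number of iterations and thresholds
        (η γ p : ℝ) (_ : η = √((n : ℝ) / T))
        (_ : γ = SparqSGD.consensusStep (SparqSGD.spectralGap hW) (SparqSGD.beta hW) ω)
        (_ : p = γ * SparqSGD.spectralGap hW / 8)
        (_ : 64 * (n : ℝ) * L ^ 2 ≤ T)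
        (ε : ℝ) (_ : 0 < ε) (_ : ε < 1)
        (c : ℕ → ℝ) (_ : ∀ t < T, c t ≤ 1 / η ^ (1 - ε))
        -- randomness and starting point
        (Ω : Type*) [MeasurableSpace Ω] (P : Measure Ω) [IsProbabilityMeasure P]
        (ξ : (i : Fin n) → ℕ → Ω → Ξ i) (ζ : Fin n → ℕ → Ω → Z)
        (_ : SparqSGD.IsSampling P D ν ξ ζ)
        (x₀ : EuclideanSpace ℝ (Fin d))
        -- the averaged iterates
        (xbar : ℕ → Ω → EuclideanSpace ℝ (Fin d))
        (_ : ∀ t w, xbar t w = (SparqSGD.iterate W γ (fun _ => η) c I g C x₀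
          (fun i s => ξ i s w) (fun i s => ζ i s w) t).mean),
        (∀ t < T, Integrable
          (fun w => ‖gradient (SparqSGD.objective f) (xbar t w)‖ ^ 2) P) ∧
        (1 / (T : ℝ)) * ∑ t ∈ Finset.range T,
            ∫ w, ‖gradient (SparqSGD.objective f) (xbar t w)‖ ^ 2 ∂P ≤
          4 * (SparqSGD.objective f x₀ - (⨅ x, SparqSGD.objective f x)
              + L * ((1 / (n : ℝ)) * ∑ i, σ i ^ 2)) / √((n : ℝ) * T)
            + K * (G ^ 2 * (H : ℝ) ^ 2 * L ^ 2 * n / (p ^ 2 * T))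
            + K * (G ^ 2 * (H : ℝ) ^ 2 * L ^ 3 * (n : ℝ) ^ (3 / 2 : ℝ)
                / (p ^ 2 * (T : ℝ) ^ (3 / 2 : ℝ)))
            + K * (L ^ 2 * ω * ((n : ℝ) / T) ^ ((1 + ε) / 2) / p)
            + K * (L ^ 3 * ω * ((n : ℝ) / T) ^ ((2 + ε) / 2) / p) := by
  refine ⟨10, by norm_num, ?_⟩
  intro n d T H hn hT Ξ _ D _ f g L G σ hL hf hb hg Z _ ν _ C ω hω hω1 hC W hW hds h2 I hI η γ p
    hη hγ hp hTL ε hε hε1 c hc Ω _ P _ ξ ζ hs x₀ xbar hxbar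
  have hrun : IsRun P D ν f g L G σ C ω W γ η c I ξ ζ x₀ _ _ :=
    { toIsTrajectory := isTrajectory_iterate
      sampling := hs
      smooth := hf
      stochasticGradient := hg
      compression := hC }
  have hxb : xbar = fun t w => avg fun i => (iterate W γ (fun _ => η) c I g C x₀
      (fun i s => ξ i s w) (fun i s => ζ i s w) t).x i := by
    funext t w; exact hxbar t w
  have hp0 : 0 ≤ p := by
    have hδ : 0 < spectralGap hW := sub_pos.2 h2
    have hstep := isConsensusStep_consensusStep hδ
      (sub_le_self _ (secondAbsEigenvalue_nonneg hW)) (beta_nonneg hn hW hds h2)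
      (beta_eq_zero_or_spectralGap_le hn hW hds h2) hω hω1
    have := hstep.pos
    rw [hp, hγ]; positivity
  have h3 : 0 ≤ 10 * (G ^ 2 * (H : ℝ) ^ 2 * L ^ 3 * (n : ℝ) ^ (3 / 2 : ℝ)
      / (p ^ 2 * (T : ℝ) ^ (3 / 2 : ℝ))) := by positivity
  have h4 : 0 ≤ 10 * (L ^ 3 * ω * ((n : ℝ) / T) ^ ((2 + ε) / 2) / p) := by positivity
  have hrate := hrun.rate hn hT hL hb hω hω1 hW hds h2 hI hη hγ hp hTL hc
  rw [hxb]
  refine ⟨fun t _ => ?_, by linarith⟩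
  exact ((lsmooth_objective hn hf).gradient_memLp
    (memLp_avg fun i => (hrun.memLp_state hω t i).1)).integrable_norm_pow two_ne_zero
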